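/- Let $0<\alpha<\infty$ and $0<p<\infty$, and let $\mathbb{D}$ be the open unit disc in $\mathbb{C}$. For $f$ analytic in $\mathbb{D}$ put \[M_p^p(r,f)=\int_0^{2\pi}|f(re^{i\theta})|^p\,\frac{d\theta}{2\pi}\quad(0<r<1),\qquad \|f\|_{\alpha,p}^p=|f(0)|^p+\int_0^1\Big(\frac{d}{dr}M_p^p(r,f)\Big)(1-r^2)^{\alpha-1}\,dr\in[0,\infty],\] and let $A^p_\alpha$ be the class of all analytic functions $f$ in $\mathbb{D}$ with $\|f\|_{\alpha,p}<\infty$. Then for every $f\in A^p_\alpha$ and every $w\in\mathbb{D}$, \[|f(w)|^p(1-|w|^2)^\alpha\le\|f\|_{\alpha,p}^p .\] Moreover, for each $w\in\mathbb{D}$, a function $f$ belongs to $A^p_\alpha$ and attains equality in this bound at the point $w$ if and only if there is a constant $C\in\mathbb{C}$ such that $f(z)=C(1-\overline{w}z)^{-2\alpha/p}$ for all $z\in\mathbb{D}$, where the power is the principal branch. -/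

import Mathlib

open MeasureTheory

noncomputable section

/-- The integral mean `M_p^p(r, f) = (1 / 2π) ∫_0^{2π} |f (r e^{iθ})|^p dθ`. -/
def integralMeanPow (p : ℝ) (f : ℂ → ℂ) (r : ℝ) : ℝ :=
  Real.circleAverage (fun z : ℂ => ‖f z‖ ^ p) 0 r

/-- The quantity
`‖f‖_{α,p}^p = |f(0)|^p + ∫_0^1 (d/dr M_p^p(r, f)) (1 - r^2)^(α - 1) dr`,
as an element of `[0, ∞]`.  For `f` analytic in the unit disc the mean is differentiable and
nondecreasing on `(0, 1)`, so the integrand is nonnegative and the integral is a well-defined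
extended nonnegative number. -/
def dirichletNormPow (α p : ℝ) (f : ℂ → ℂ) : ENNReal :=
  ENNReal.ofReal (‖f 0‖ ^ p) +
    ∫⁻ r in Set.Ioo (0 : ℝ) 1,
      ENNReal.ofReal (deriv (integralMeanPow p f) r * (1 - r ^ 2) ^ (α - 1))

/-- The class `A^p_α` of all functions `f` analytic in the unit disc with `‖f‖_{α,p} < ∞`.
A function on the disc is represented by any extension of it to `ℂ`; only the values in the
disc matter. -/
def dirichletClass (α p : ℝ) : Set (ℂ → ℂ) :=
  {f | AnalyticOnNhd ℂ f (Metric.ball 0 1) ∧ dirichletNormPow α p f < ⊤}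

end

/-!
For `α ≤ 1`, integrate by parts: the part of the norm coming from `|z| < ρ` is `M_p^p(ρ, f)` times
a constant plus the integral of `M_p^p(·, f)` against a nonpositive density. Dividing out the zeros
of `f` in `|z| < ρ` by a Blaschke product therefore does not increase it, but increases `|f(w)|`,
strictly if there are zeros. For zero-free `f` write `f ^ (p / 2) = ∑ aₙ zⁿ`; then
`‖f‖_{α,p}^p = ∑ |aₙ|² / cₙ` with `cₙ = Γ(n + α) / (n! Γ(α))` the coefficients of `(1 - z) ^ (-α)`,
and the bound at `w` is Cauchy–Schwarz against the reproducing kernel `(1 - w̄z) ^ (-α)`.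

For `α > 1` the same integration by parts has a nonnegative density and bounds the norm below by
that of a weighted Bergman space. Weighted composition with the disc automorphism exchanging `0`
and `w` preserves the latter up to a constant, which reduces the bound to
`|g(0)|^p ≤ M_p^p(r, g)` for the transformed function `g`. Equality forces `M_p^p(·, g)` to be
constant, which is the case of equality at `w = 0` for the exponent `α = 1`.
-/

section

open Metric Complex Filter Topology Set
open scoped ComplexConjugate

theorem norm_sq_sub_conj_mul (ρ : ℝ) (a z : ℂ) :
    ‖(ρ : ℂ) ^ 2 - conj a * z‖ ^ 2 - ‖(ρ : ℂ) * (z - a)‖ ^ 2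
      = (ρ ^ 2 - ‖a‖ ^ 2) * (ρ ^ 2 - ‖z‖ ^ 2) := by
  simp only [Complex.sq_norm, Complex.normSq_apply]
  simp only [pow_two, sub_re, mul_re, ofReal_re, ofReal_im, conj_re, conj_im, sub_im, mul_im]
  ring

theorem one_lt_norm_canonicalFactor {ρ : ℝ} {a z : ℂ} (ha : a ∈ ball (0 : ℂ) ρ)
    (hz : z ∈ ball (0 : ℂ) ρ) (hza : z ≠ a) : 1 < ‖canonicalFactor ρ a z‖ := by
  rw [mem_ball_zero_iff] at ha hz
  have hρ : 0 < ρ := (norm_nonneg a).trans_lt ha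
  have hden : 0 < ‖(ρ : ℂ) * (z - a)‖ :=
    norm_pos_iff.2 (mul_ne_zero (mod_cast hρ.ne') (sub_ne_zero.2 hza))
  rw [canonicalFactor_apply, norm_div, one_lt_div hden]
  refine lt_of_pow_lt_pow_left₀ 2 (norm_nonneg _) (sub_pos.1 ?_)
  rw [norm_sq_sub_conj_mul]
  exact mul_pos (by nlinarith [norm_nonneg a]) (by nlinarith [norm_nonneg z])

theorem one_le_norm_canonicalFactor {ρ : ℝ} {a z : ℂ} (ha : a ∈ ball (0 : ℂ) ρ)
    (hz : z ∈ closedBall (0 : ℂ) ρ) (hza : z ≠ a) : 1 ≤ ‖canonicalFactor ρ a z‖ := by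
  rcases (mem_closedBall_zero_iff.1 hz).eq_or_lt with h | h
  · exact (norm_canonicalFactor_eval_circle_eq_one ha (mem_sphere_zero_iff_norm.2 h)).ge
  · exact (one_lt_norm_canonicalFactor ha (mem_ball_zero_iff.2 h) hza).le

/-- `g` has the properties of the quotient of `f` by the Blaschke product of its zeros in the disc
`|z| < ρ`. Here `canonicalFactor ρ a` is the reciprocal of the Blaschke factor at `a`, with the
junk value `0` at `a`. -/
structure IsZeroFreeMajorant (ρ : ℝ) (f g : ℂ → ℂ) : Prop where
  analyticOnNhd : AnalyticOnNhd ℂ g (closedBall 0 ρ)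
  ne_zero : ∀ z ∈ ball (0 : ℂ) ρ, g z ≠ 0
  norm_le : ∀ z ∈ closedBall (0 : ℂ) ρ, ‖f z‖ ≤ ‖g z‖
  norm_mul_canonicalFactor_le : ∀ a ∈ ball (0 : ℂ) ρ, f a = 0 →
    ∀ z ∈ closedBall (0 : ℂ) ρ, ‖f z‖ * ‖canonicalFactor ρ a z‖ ≤ ‖g z‖
  norm_eq_of_mem_sphere : ∀ z ∈ sphere (0 : ℂ) ρ, ‖f z‖ = ‖g z‖

theorem meromorphicOrderAt_ne_top_of_exists_ne_zero {ρ : ℝ} {f : ℂ → ℂ} (hρ : 0 ≤ ρ)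
    (hf : AnalyticOnNhd ℂ f (closedBall 0 ρ)) (hne : ∃ z ∈ closedBall (0 : ℂ) ρ, f z ≠ 0)
    (u : closedBall (0 : ℂ) ρ) : meromorphicOrderAt f u ≠ ⊤ := by
  refine (hf.meromorphicOn.exists_meromorphicOrderAt_ne_top_iff_forall
    (isConnected_closedBall hρ)).1 ?_ u
  obtain ⟨z, hz, hfz⟩ := hne
  refine ⟨⟨z, hz⟩, ?_⟩
  rw [((hf z hz).meromorphicNFAt.meromorphicOrderAt_eq_zero_iff).2 hfz]
  exact WithTop.zero_ne_top

theorem mem_support_divisor_iff {U : Set ℂ} {f : ℂ → ℂ} (hf : AnalyticOnNhd ℂ f U)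
    (htop : ∀ u ∈ U, meromorphicOrderAt f u ≠ ⊤) {u : ℂ} :
    u ∈ (MeromorphicOn.divisor f U).support ↔ u ∈ U ∧ f u = 0 := by
  by_cases hu : u ∈ U
  · rw [Function.mem_support, MeromorphicOn.divisor_apply hf.meromorphicOn hu, Ne,
      WithTop.untop₀_eq_zero, or_iff_left (htop u hu),
      (hf u hu).meromorphicNFAt.meromorphicOrderAt_eq_zero_iff, not_not, and_iff_right hu]
  · exact iff_of_false (fun h => hu ((MeromorphicOn.divisor f U).supportWithinDomain h))
      fun h => hu h.1

theorem eq_of_eventuallyEq_codiscreteWithin_closedBall {ρ : ℝ} {f g : ℂ → ℂ} {z : ℂ}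
    (hρ : 0 < ρ) (hz : z ∈ closedBall (0 : ℂ) ρ) (hf : AnalyticAt ℂ f z) (hg : AnalyticAt ℂ g z)
    (h : f =ᶠ[codiscreteWithin (closedBall 0 ρ)] g) : f z = g z := by
  have hperf : Preperfect (closedBall (0 : ℂ) ρ) := by
    rw [← closure_ball 0 hρ.ne']
    exact isOpen_ball.perfect_closure.2
  have hnhds := MeromorphicAt.eventuallyEq_nhdsNE_of_eventuallyEq_codiscreteWithin_preperfect
    hf.meromorphicAt hg.meromorphicAt hz hperf h
  exact ((hf.continuousAt.eventuallyEq_nhds_iff_eventuallyEq_nhdsNE hg.continuousAt).1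
    hnhds).eq_of_nhds

theorem prod_canonicalFactor_zpow_neg_mul_prod_pow {ρ : ℝ} {Z : Finset ℂ} {m : ℂ → ℤ} {z : ℂ}
    (hZ : ∀ u ∈ Z, u ∈ ball (0 : ℂ) ρ) (hm : ∀ u, 0 ≤ m u) (hz : z ∈ closedBall (0 : ℂ) ρ)
    (hzZ : z ∉ Z) :
    (∏ u ∈ Z, canonicalFactor ρ u z ^ (-m u)) * ∏ u ∈ Z, canonicalFactor ρ u z ^ (m u).toNat
      = 1 := by
  rw [← Finset.prod_mul_distrib]
  refine Finset.prod_eq_one fun u hu => ?_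
  rw [← zpow_natCast, Int.toNat_of_nonneg (hm u), zpow_neg]
  exact inv_mul_cancel₀ (zpow_ne_zero _
    (canonicalFactor_ne_zero (hZ u hu) hz (ne_of_mem_of_not_mem hu hzZ).symm))

theorem exists_finite_blaschke_factorization {ρ : ℝ} {f : ℂ → ℂ} (hρ : 0 < ρ)
    (hf : AnalyticOnNhd ℂ f (closedBall 0 ρ)) (hne : ∃ z ∈ closedBall (0 : ℂ) ρ, f z ≠ 0) :
    ∃ (Z : Finset ℂ) (d : ℂ → ℕ) (g : ℂ → ℂ),
      (∀ u, u ∈ Z ↔ u ∈ ball 0 ρ ∧ f u = 0) ∧ (∀ u ∈ Z, d u ≠ 0) ∧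
      AnalyticOnNhd ℂ g (closedBall 0 ρ) ∧ (∀ z ∈ ball (0 : ℂ) ρ, g z ≠ 0) ∧
      ∀ z ∈ closedBall (0 : ℂ) ρ, z ∉ Z → f z * ∏ u ∈ Z, canonicalFactor ρ u z ^ d u = g z := by
  have htop := meromorphicOrderAt_ne_top_of_exists_ne_zero hρ.le hf hne
  obtain ⟨g, D⟩ := hf.meromorphicOn.exists_canonicalDecomp htop
  have hfg := D.eventuallyEq
  have hball : AnalyticOnNhd ℂ f (ball 0 ρ) := hf.mono ball_subset_closedBall
  set δ := MeromorphicOn.divisor f (ball 0 ρ)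
  have hδ : ∀ u, 0 ≤ δ u := MeromorphicOn.AnalyticOnNhd.divisor_nonneg hball
  have hfin : δ.support.Finite := hf.meromorphicOn.divisor_ball_support_finite
  have hZ : ∀ u, u ∈ hfin.toFinset ↔ u ∈ ball 0 ρ ∧ f u = 0 := fun u => hfin.mem_toFinset.trans
    (mem_support_divisor_iff hball fun u hu => htop ⟨u, ball_subset_closedBall hu⟩)
  have hg : AnalyticOnNhd ℂ g (closedBall 0 ρ) :=
    D.meromorphicNFOn.divisor_nonneg_iff_analyticOnNhd.1 fun x =>
      (D.divisor_eq_divisor hρ).symm ▸ MeromorphicOn.AnalyticOnNhd.divisor_nonneg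
        (hf.mono sphere_subset_closedBall) x
  refine ⟨hfin.toFinset, fun u => (δ u).toNat, g, hZ, fun u hu => ?_, hg, D.ne_zero,
    fun z hz hzZ => ?_⟩
  · have : δ u ≠ 0 := hfin.mem_toFinset.1 hu
    exact fun h => this (le_antisymm (Int.toNat_eq_zero.1 h) (hδ u))
  · have hanalytic : AnalyticAt ℂ
        (fun z => f z * ∏ u ∈ hfin.toFinset, canonicalFactor ρ u z ^ (δ u).toNat) z :=
      (hf z hz).mul (Finset.analyticAt_fun_prod _ fun u hu =>
        (analyticOnNhd_canonicalFactor ρ u z (ne_of_mem_of_not_mem hu hzZ).symm).pow _)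
    have hsupp : (fun u => canonicalFactor ρ u ^ (-δ u)).mulSupport ⊆ δ.support :=
      Function.mulSupport_subset_iff'.2 fun u hu => by simp [Function.notMem_support.1 hu]
    refine eq_of_eventuallyEq_codiscreteWithin_closedBall hρ hz hanalytic (hg z hz) ?_
    filter_upwards [hfg, self_mem_codiscreteWithin (closedBall (0 : ℂ) ρ),
      codiscreteWithin_mono (subset_univ _) hfin.compl_mem_codiscrete] with x hx hxball hxZ
    rw [hx, finprod_eq_prod_of_mulSupport_subset_of_finite _ hsupp hfin]
    simp only [Pi.smul_apply', Finset.prod_apply, Pi.pow_apply, smul_eq_mul]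
    rw [mul_right_comm,
      prod_canonicalFactor_zpow_neg_mul_prod_pow (fun u hu => ((hZ u).1 hu).1) hδ hxball
      (fun h => hxZ (hfin.mem_toFinset.1 h)), one_mul]

theorem exists_isZeroFreeMajorant {ρ : ℝ} {f : ℂ → ℂ} (hρ : 0 < ρ)
    (hf : AnalyticOnNhd ℂ f (closedBall 0 ρ)) (hne : ∃ z ∈ closedBall (0 : ℂ) ρ, f z ≠ 0) :
    ∃ g, IsZeroFreeMajorant ρ f g := by
  obtain ⟨Z, d, g, hZ, hd, hg, hg0, hfg⟩ := exists_finite_blaschke_factorization hρ hf hne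
  have hfactor : ∀ z ∈ closedBall (0 : ℂ) ρ, z ∉ Z → ∀ u ∈ Z, 1 ≤ ‖canonicalFactor ρ u z ^ d u‖ :=
    fun z hz hzZ u hu => (one_le_pow₀ (one_le_norm_canonicalFactor ((hZ u).1 hu).1 hz
      (ne_of_mem_of_not_mem hu hzZ).symm)).trans_eq (norm_pow _ _).symm
  have hnorm : ∀ z ∈ closedBall (0 : ℂ) ρ, z ∉ Z →
      ‖f z‖ * ∏ u ∈ Z, ‖canonicalFactor ρ u z ^ d u‖ = ‖g z‖ := fun z hz hzZ => by
    rw [← hfg z hz hzZ, norm_mul, norm_prod]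
  refine ⟨g, hg, hg0, fun z hz => ?_, fun a ha hfa z hz => ?_, fun z hz => ?_⟩
  · by_cases hzZ : z ∈ Z
    · simp [((hZ z).1 hzZ).2]
    · rw [← hnorm z hz hzZ]
      exact le_mul_of_one_le_right (norm_nonneg _)
        (Finset.one_le_prod (hfactor z hz hzZ))
  · by_cases hzZ : z ∈ Z
    · simp [((hZ z).1 hzZ).2]
    · have haZ : a ∈ Z := (hZ a).2 ⟨ha, hfa⟩
      rw [← hnorm z hz hzZ]
      gcongr
      calc ‖canonicalFactor ρ a z‖ ≤ ‖canonicalFactor ρ a z ^ d a‖ := by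
            rw [norm_pow]
            exact le_self_pow₀ (one_le_norm_canonicalFactor ha hz
              (ne_of_mem_of_not_mem haZ hzZ).symm) (hd a haZ)
        _ ≤ ∏ u ∈ Z, ‖canonicalFactor ρ u z ^ d u‖ :=
            (Finset.prod_singleton _ _).symm.trans_le (Finset.prod_le_prod_of_subset_of_one_le
              (Finset.singleton_subset_iff.2 haZ) (fun _ _ => norm_nonneg _)
              fun u hu _ => hfactor z hz hzZ u hu)
  · have hzZ : z ∉ Z := fun h => by
      simpa [mem_sphere_zero_iff_norm.1 hz] using ((hZ z).1 h).1
    rw [← hnorm z (sphere_subset_closedBall hz) hzZ, Finset.prod_eq_one fun u hu => ?_, mul_one]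
    rw [norm_pow, norm_canonicalFactor_eval_circle_eq_one ((hZ u).1 hu).1 hz, one_pow]

theorem exists_norm_rpow_eq_norm_sq (p : ℝ) {ρ : ℝ} {g : ℂ → ℂ}
    (hg : AnalyticOnNhd ℂ g (ball 0 ρ)) (h0 : ∀ z ∈ ball (0 : ℂ) ρ, g z ≠ 0) :
    ∃ h : ℂ → ℂ, AnalyticOnNhd ℂ h (ball 0 ρ) ∧ ∀ z ∈ ball (0 : ℂ) ρ, ‖g z‖ ^ p = ‖h z‖ ^ 2 := by
  obtain ⟨F, hF, hre⟩ := InnerProductSpace.HarmonicOnNhd.exists_analyticOnNhd_ball_re_eq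
    fun z hz => (hg z hz).harmonicAt_log_norm (h0 z hz)
  refine ⟨fun z => exp (p / 2 * F z), fun z hz => ?_, fun z hz => ?_⟩
  · exact (analyticAt_const.mul (hF z hz)).cexp
  · have hlog : Real.log ‖g z‖ = (F z).re := (hre hz).symm
    rw [norm_exp, Real.rpow_def_of_pos (norm_pos_iff.2 (h0 z hz)), hlog, ← Real.exp_nat_mul]
    congr 1
    rw [show (p / 2 * F z : ℂ) = ((p / 2 : ℝ) : ℂ) * F z by push_cast; rfl, re_ofReal_mul]
    push_cast
    ring

theorem summable_norm_sq {a : ℕ → ℂ} (ha : Summable fun n => ‖a n‖) :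
    Summable fun n => ‖a n‖ ^ 2 := by
  refine Summable.of_nonneg_of_le (fun n => by positivity) (fun n => ?_)
    (ha.mul_left (∑' n, ‖a n‖))
  rw [sq]
  exact mul_le_mul_of_nonneg_right (ha.le_tsum n fun _ _ => norm_nonneg _) (norm_nonneg _)

theorem circleAverage_norm_sum_range_sq (a : ℕ → ℂ) (N : ℕ) :
    Real.circleAverage (fun z => ‖∑ n ∈ Finset.range N, a n * z ^ n‖ ^ 2) 0 1
      = ∑ n ∈ Finset.range N, ‖a n‖ ^ 2 := by
  set P : Polynomial ℂ := ∑ n ∈ Finset.range N, Polynomial.monomial n (a n) with hP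
  have hcoeff : ∀ n, P.coeff n = if n < N then a n else 0 := fun n => by
    simp [hP, Polynomial.coeff_monomial]
  have heval : ∀ z, P.eval z = ∑ n ∈ Finset.range N, a n * z ^ n := fun z => by
    simp [hP, Polynomial.eval_finsetSum]
  simp only [← heval]
  rw [← Polynomial.sum_sq_norm_coeff_eq_circleAverage]
  refine (Finset.sum_subset (fun n hn => ?_) fun n _ hn => ?_).trans
    (Finset.sum_congr rfl fun n hn => ?_)
  · by_contra h
    exact Polynomial.mem_support_iff.1 hn (by rw [hcoeff, if_neg (mt Finset.mem_range.2 h)])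
  · simp [Polynomial.notMem_support_iff.1 hn]
  · rw [hcoeff, if_pos (Finset.mem_range.1 hn)]

theorem circleAverage_norm_tsum_sq {a : ℕ → ℂ} (ha : Summable fun n => ‖a n‖) :
    Real.circleAverage (fun z => ‖∑' n, a n * z ^ n‖ ^ 2) 0 1 = ∑' n, ‖a n‖ ^ 2 := by
  have hnorm : ∀ θ n, ‖a n * circleMap 0 1 θ ^ n‖ = ‖a n‖ := fun θ n => by simp
  have hsum : Tendsto (fun N => ∑ n ∈ Finset.range N, ‖a n‖ ^ 2) atTop (𝓝 (∑' n, ‖a n‖ ^ 2)) :=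
    (summable_norm_sq ha).hasSum.tendsto_sum_nat
  simp only [← circleAverage_norm_sum_range_sq] at hsum
  refine tendsto_nhds_unique ?_ hsum
  simp only [Real.circleAverage_def]
  refine (intervalIntegral.tendsto_integral_filter_of_dominated_convergence
    (fun _ => (∑' n, ‖a n‖) ^ 2) (.of_forall fun N => ?_) (.of_forall fun N => ?_)
    intervalIntegrable_const ?_).const_smul _
  · have : Continuous (circleMap 0 1) := continuous_circleMap 0 1
    exact Continuous.aestronglyMeasurable (by fun_prop)
  · refine .of_forall fun θ _ => ?_
    rw [norm_pow, norm_norm]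
    gcongr
    calc ‖∑ n ∈ Finset.range N, a n * circleMap 0 1 θ ^ n‖
        ≤ ∑ n ∈ Finset.range N, ‖a n‖ := norm_sum_le_of_le _ fun n _ => (hnorm θ n).le
      _ ≤ ∑' n, ‖a n‖ := ha.sum_le_tsum _ fun _ _ => norm_nonneg _
  · refine .of_forall fun θ _ => ?_
    have : Summable fun n => a n * circleMap 0 1 θ ^ n :=
      .of_norm (ha.congr fun n => (hnorm θ n).symm)
    exact (this.hasSum.tendsto_sum_nat.norm).pow 2

/-- `∑ aₙ zⁿ` converges in `|z| < ρ` and plays the role of `f ^ (p / 2)` there: only the identity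
`|f|^p = |∑ aₙ zⁿ|²` is recorded, so no branch has to be chosen. -/
structure IsHalfPowerSeries (p ρ : ℝ) (f : ℂ → ℂ) (a : ℕ → ℂ) : Prop where
  summable : ∀ z ∈ ball (0 : ℂ) ρ, Summable fun n => a n * z ^ n
  norm_rpow_eq : ∀ z ∈ ball (0 : ℂ) ρ, ‖f z‖ ^ p = ‖∑' n, a n * z ^ n‖ ^ 2

theorem exists_isHalfPowerSeries (p : ℝ) {ρ : ℝ} {g : ℂ → ℂ} (hg : AnalyticOnNhd ℂ g (ball 0 ρ))
    (h0 : ∀ z ∈ ball (0 : ℂ) ρ, g z ≠ 0) : ∃ a, IsHalfPowerSeries p ρ g a := by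
  obtain ⟨h, hh, hgh⟩ := exists_norm_rpow_eq_norm_sq p hg h0
  have hsum : ∀ z ∈ ball (0 : ℂ) ρ,
      HasSum (fun n => ((n.factorial : ℂ)⁻¹ * iteratedDeriv n h 0) * z ^ n) (h z) := fun z hz => by
    refine (hasSum_taylorSeries_on_ball hh.differentiableOn hz).congr_fun fun n => ?_
    simp only [sub_zero, smul_eq_mul]
    ring
  exact ⟨_, fun z hz => (hsum z hz).summable, fun z hz => by rw [hgh z hz, (hsum z hz).tsum_eq]⟩

namespace IsHalfPowerSeries

variable {p ρ : ℝ} {f : ℂ → ℂ} {a : ℕ → ℂ} {s : ℝ}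

theorem summable_norm (h : IsHalfPowerSeries p ρ f a) (hs : s ∈ Ico 0 ρ) :
    Summable fun n => ‖a n * (s : ℂ) ^ n‖ :=
  (h.summable s (by simpa [abs_of_nonneg hs.1] using hs.2)).norm

theorem summable_norm_sq_mul_pow (h : IsHalfPowerSeries p ρ f a) (hs : s ∈ Ico 0 ρ) :
    Summable fun n => ‖a n‖ ^ 2 * s ^ (2 * n) := by
  refine (summable_norm_sq (h.summable_norm hs)).congr fun n => ?_
  simp [mul_pow, ← pow_mul, mul_comm, abs_of_nonneg hs.1]

theorem integralMeanPow_eq_tsum (h : IsHalfPowerSeries p ρ f a) (hs : s ∈ Ico 0 ρ) :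
    integralMeanPow p f s = ∑' n, ‖a n‖ ^ 2 * s ^ (2 * n) := by
  have hmean := circleAverage_norm_tsum_sq (h.summable_norm hs)
  rw [integralMeanPow, Real.circleAverage_eq_circleAverage_zero_one]
  convert hmean using 1
  · refine Real.circleAverage_congr_sphere fun z hz => ?_
    have hz : ‖z‖ = 1 := by simpa using hz
    have hsz : (s : ℂ) * z ∈ ball (0 : ℂ) ρ := by simpa [hz, abs_of_nonneg hs.1] using hs.2
    simp only [add_zero]
    rw [h.norm_rpow_eq _ hsz]
    simp only [mul_pow, mul_assoc]
  · refine tsum_congr fun n => ?_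
    simp [mul_pow, ← pow_mul, mul_comm, abs_of_nonneg hs.1]

theorem monotoneOn_integralMeanPow (h : IsHalfPowerSeries p ρ f a) :
    MonotoneOn (integralMeanPow p f) (Ico 0 ρ) := fun s hs t ht hst => by
  rw [h.integralMeanPow_eq_tsum hs, h.integralMeanPow_eq_tsum ht]
  refine Summable.tsum_le_tsum (fun n => ?_) (h.summable_norm_sq_mul_pow hs)
    (h.summable_norm_sq_mul_pow ht)
  have := hs.1
  gcongr

end IsHalfPowerSeries

section IntegralMean

variable {p ρ s : ℝ} {f g : ℂ → ℂ}

theorem continuousOn_norm_rpow {U : Set ℂ} (hp : 0 < p) (hf : AnalyticOnNhd ℂ f U) :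
    ContinuousOn (fun z => ‖f z‖ ^ p) U :=
  hf.continuousOn.norm.rpow_const fun _ _ => Or.inr hp.le

theorem continuousOn_integralMeanPow (hp : 0 < p) (hf : AnalyticOnNhd ℂ f (closedBall 0 ρ)) :
    ContinuousOn (integralMeanPow p f) (Icc 0 ρ) := by
  refine Real.ContinuousOn.circleAverage ?_ fun r hr => hr.1
  exact (continuousOn_norm_rpow hp hf).mono fun z hz => by simpa using hz.2

theorem integralMeanPow_nonneg (p : ℝ) (f : ℂ → ℂ) (s : ℝ) : 0 ≤ integralMeanPow p f s :=
  Real.circleAverage_nonneg_of_nonneg fun _ _ => Real.rpow_nonneg (norm_nonneg _) _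

theorem integralMeanPow_zero (p : ℝ) (f : ℂ → ℂ) : integralMeanPow p f 0 = ‖f 0‖ ^ p := by
  simp [integralMeanPow]

theorem integralMeanPow_le_of_norm_le (hp : 0 < p) (hs : 0 ≤ s)
    (hf : AnalyticOnNhd ℂ f (sphere 0 s)) (hg : AnalyticOnNhd ℂ g (sphere 0 s))
    (hfg : ∀ z ∈ sphere (0 : ℂ) s, ‖f z‖ ≤ ‖g z‖) :
    integralMeanPow p f s ≤ integralMeanPow p g s := by
  refine Real.circleAverage_mono ((continuousOn_norm_rpow hp hf).circleIntegrable hs)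
    ((continuousOn_norm_rpow hp hg).circleIntegrable hs) fun z hz => ?_
  rw [abs_of_nonneg hs] at hz
  exact Real.rpow_le_rpow (norm_nonneg _) (hfg z hz) hp.le

theorem integralMeanPow_congr_of_norm_eq (hs : 0 ≤ s)
    (hfg : ∀ z ∈ sphere (0 : ℂ) s, ‖f z‖ = ‖g z‖) :
    integralMeanPow p f s = integralMeanPow p g s := by
  refine Real.circleAverage_congr_sphere fun z hz => ?_
  rw [abs_of_nonneg hs] at hz
  simp only [hfg z hz]

theorem integralMeanPow_eq_zero (hp : 0 < p) (hs : 0 ≤ s)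
    (h : ∀ z ∈ sphere (0 : ℂ) s, f z = 0) : integralMeanPow p f s = 0 := by
  refine Real.circleAverage_const_on_circle fun z hz => ?_
  rw [abs_of_nonneg hs] at hz
  simp [h z hz, Real.zero_rpow hp.ne']

theorem integralMeanPow_le_of_ne_zero (hp : 0 < p) (hf : AnalyticOnNhd ℂ f (closedBall 0 ρ))
    (h0 : ∀ z ∈ ball (0 : ℂ) ρ, f z ≠ 0) (hs : s ∈ Icc 0 ρ) :
    integralMeanPow p f s ≤ integralMeanPow p f ρ := by
  rcases hs.2.eq_or_lt with rfl | hsρ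
  · exact le_rfl
  obtain ⟨a, ha⟩ := exists_isHalfPowerSeries p (hf.mono ball_subset_closedBall) h0
  have hlim : Tendsto (integralMeanPow p f) (𝓝[<] ρ) (𝓝 (integralMeanPow p f ρ)) :=
    ((continuousOn_integralMeanPow hp hf) ρ ⟨hs.1.trans hs.2, le_rfl⟩).mono_of_mem_nhdsWithin
      (Icc_mem_nhdsLT (hs.1.trans_lt hsρ))
  refine ge_of_tendsto hlim ?_
  filter_upwards [Ioo_mem_nhdsLT hsρ] with t ht
  exact ha.monotoneOn_integralMeanPow ⟨hs.1, hsρ⟩ ⟨hs.1.trans ht.1.le, ht.2⟩ ht.1.le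

theorem integralMeanPow_le (hp : 0 < p) (hf : AnalyticOnNhd ℂ f (closedBall 0 ρ))
    (hs : s ∈ Icc 0 ρ) : integralMeanPow p f s ≤ integralMeanPow p f ρ := by
  rcases hs.2.eq_or_lt with rfl | hsρ
  · exact le_rfl
  have hsphere : sphere (0 : ℂ) s ⊆ closedBall 0 ρ :=
    sphere_subset_closedBall.trans (closedBall_subset_closedBall hs.2)
  by_cases hne : ∃ z ∈ closedBall (0 : ℂ) ρ, f z ≠ 0
  · obtain ⟨g, hg⟩ := exists_isZeroFreeMajorant (hs.1.trans_lt hsρ) hf hne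
    calc integralMeanPow p f s ≤ integralMeanPow p g s :=
          integralMeanPow_le_of_norm_le hp hs.1 (hf.mono hsphere)
            (hg.analyticOnNhd.mono hsphere) fun z hz => hg.norm_le z (hsphere hz)
      _ ≤ integralMeanPow p g ρ := integralMeanPow_le_of_ne_zero hp hg.analyticOnNhd hg.ne_zero hs
      _ = integralMeanPow p f ρ :=
          (integralMeanPow_congr_of_norm_eq (hs.1.trans hs.2) hg.norm_eq_of_mem_sphere).symm
  · push Not at hne
    rw [integralMeanPow_eq_zero hp hs.1 fun z hz => hne z (hsphere hz)]
    exact integralMeanPow_nonneg _ _ _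

theorem monotoneOn_integralMeanPow (hp : 0 < p) (hf : AnalyticOnNhd ℂ f (closedBall 0 ρ)) :
    MonotoneOn (integralMeanPow p f) (Icc 0 ρ) := fun _ hs _ ht hst =>
  integralMeanPow_le hp (hf.mono (closedBall_subset_closedBall ht.2)) ⟨hs.1, hst⟩

end IntegralMean

theorem hasDerivAt_circleMap_radius (c : ℂ) (r θ : ℝ) :
    HasDerivAt (fun r => circleMap c r θ) (exp (θ * I)) r := by
  have h := ((hasDerivAt_id r).ofReal_comp.mul_const (exp (θ * I))).const_add c
  simpa [circleMap] using h

theorem dist_circleMap_radius (c : ℂ) (r s θ : ℝ) :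
    dist (circleMap c r θ) (circleMap c s θ) = dist r s := by
  rw [dist_eq_norm, circleMap, circleMap, add_sub_add_left_eq_sub, ← sub_mul, ← ofReal_sub,
    norm_mul, norm_exp_ofReal_mul_I, mul_one, norm_real, dist_eq_norm]

theorem differentiableAt_circleAverage {u : ℂ → ℝ} {U : Set ℂ} {c : ℂ} {s : ℝ} (hU : IsOpen U)
    (hu : ContDiffOn ℝ 1 u U) (hs : sphere c |s| ⊆ U) :
    DifferentiableAt ℝ (Real.circleAverage u c) s := by
  obtain ⟨δ, hδ, hδU⟩ := (isCompact_sphere c |s|).exists_cthickening_subset_open hU hs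
  have hmem : ∀ r ∈ ball s δ, ∀ θ, circleMap c r θ ∈ cthickening δ (sphere c |s|) := fun r hr θ =>
    mem_cthickening_of_dist_le _ _ _ _ (circleMap_mem_sphere' c s θ)
      ((dist_circleMap_radius c r s θ).trans_le (mem_ball.1 hr).le)
  have hdu : ContinuousOn (fderiv ℝ u) U := hu.continuousOn_fderiv_of_isOpen hU le_rfl
  obtain ⟨C, hC⟩ := (isCompact_sphere c |s|).cthickening.exists_bound_of_continuousOn
    (hdu.mono hδU)
  have hcont : ∀ r ∈ ball s δ, Continuous fun θ => u (circleMap c r θ) := fun r hr =>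
    hu.continuousOn.comp_continuous (continuous_circleMap c r) fun θ => hδU (hmem r hr θ)
  have hcont' : Continuous fun θ : ℝ => fderiv ℝ u (circleMap c s θ) (exp (θ * I)) :=
    (hdu.comp_continuous (continuous_circleMap c s) fun θ =>
      hδU (hmem s (mem_ball_self hδ) θ)).clm_apply (by fun_prop)
  have key := intervalIntegral.hasDerivAt_integral_of_dominated_loc_of_deriv_le
    (μ := volume) (a := 0) (b := 2 * Real.pi) (bound := fun _ => C)
    (F := fun r θ => u (circleMap c r θ))
    (F' := fun r θ => fderiv ℝ u (circleMap c r θ) (exp (θ * I)))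
    (ball_mem_nhds s hδ)
    (eventually_of_mem (ball_mem_nhds s hδ) fun r hr => (hcont r hr).aestronglyMeasurable)
    ((hcont s (mem_ball_self hδ)).intervalIntegrable _ _) hcont'.aestronglyMeasurable
    (.of_forall fun θ _ r hr => by
      simpa using (fderiv ℝ u _).le_of_opNorm_le (hC _ (hmem r hr θ)) (exp (θ * I)))
    intervalIntegrable_const
    (.of_forall fun θ _ r hr =>
      ((hu.contDiffAt (hU.mem_nhds (hδU (hmem r hr θ)))).differentiableAt
        one_ne_zero).hasFDerivAt.comp_hasDerivAt r (hasDerivAt_circleMap_radius c r θ))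
  exact (key.2.const_smul (2 * Real.pi)⁻¹).differentiableAt

section Derivative

variable {p ρ s : ℝ} {f : ℂ → ℂ}

theorem differentiableAt_integralMeanPow (hf : AnalyticOnNhd ℂ f (ball 0 ρ)) (hs : s ∈ Ioo 0 ρ)
    (h0 : ∀ z ∈ sphere (0 : ℂ) s, f z ≠ 0) :
    DifferentiableAt ℝ (integralMeanPow p f) s := by
  have hU : IsOpen (ball (0 : ℂ) ρ ∩ f ⁻¹' {0}ᶜ) :=
    hf.continuousOn.isOpen_inter_preimage isOpen_ball isOpen_compl_singleton
  refine differentiableAt_circleAverage (u := fun z => ‖f z‖ ^ p) hU (fun z hz => ?_) fun z hz => ?_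
  · exact ((((hf z hz.1).contDiffAt.restrict_scalars ℝ).norm ℝ hz.2).rpow_const_of_ne
      (norm_ne_zero_iff.2 hz.2)).contDiffWithinAt
  · rw [abs_of_pos hs.1] at hz
    exact ⟨sphere_subset_ball hs.2 hz, h0 z hz⟩

theorem exists_countable_differentiableAt_integralMeanPow (hp : 0 < p) (hρ : 0 < ρ)
    (hf : AnalyticOnNhd ℂ f (closedBall 0 ρ)) :
    ∃ S : Set ℝ, S.Countable ∧ ∀ s ∈ Ioo 0 ρ \ S, DifferentiableAt ℝ (integralMeanPow p f) s := by
  by_cases hne : ∃ z ∈ closedBall (0 : ℂ) ρ, f z ≠ 0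
  · obtain ⟨Z, _, _, hZ, -⟩ := exists_finite_blaschke_factorization hρ hf hne
    refine ⟨norm '' (Z : Set ℂ), (Z.finite_toSet.image _).countable, fun s hs => ?_⟩
    refine differentiableAt_integralMeanPow (hf.mono ball_subset_closedBall) hs.1 fun z hz h0 =>
      hs.2 ⟨z, (hZ z).2 ⟨sphere_subset_ball hs.1.2 hz, h0⟩, mem_sphere_zero_iff_norm.1 hz⟩
  · push Not at hne
    refine ⟨∅, countable_empty, fun s hs => ?_⟩
    refine (differentiableAt_const (0 : ℝ)).congr_of_eventuallyEq ?_
    filter_upwards [Ioo_mem_nhds hs.1.1 hs.1.2] with t ht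
    exact integralMeanPow_eq_zero hp ht.1.le fun z hz => hne z
      (closedBall_subset_closedBall ht.2.le (sphere_subset_closedBall hz))

theorem deriv_integralMeanPow_nonneg (hp : 0 < p) (hf : AnalyticOnNhd ℂ f (closedBall 0 ρ))
    (hs : s ∈ Ioo 0 ρ) : 0 ≤ deriv (integralMeanPow p f) s := by
  rw [← derivWithin_of_mem_nhds (Icc_mem_nhds hs.1 hs.2)]
  exact (monotoneOn_integralMeanPow hp hf).derivWithin_nonneg

end Derivative

theorem one_sub_sq_pos {s : ℝ} (h0 : 0 ≤ s) (h1 : s < 1) : 0 < 1 - s ^ 2 :=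
  sub_pos.2 ((sq_lt_one_iff₀ h0).2 h1)

theorem hasDerivAt_one_sub_sq_rpow (β : ℝ) {s : ℝ} (hs : 1 - s ^ 2 ≠ 0) :
    HasDerivAt (fun s : ℝ => (1 - s ^ 2) ^ β) (-(2 * β * s * (1 - s ^ 2) ^ (β - 1))) s := by
  refine (((hasDerivAt_pow 2 s).const_sub 1).rpow_const (Or.inl hs)).congr_deriv ?_
  push_cast
  ring

theorem continuousOn_one_sub_sq_rpow (β : ℝ) {ρ : ℝ} (hρ : ρ < 1) :
    ContinuousOn (fun s : ℝ => (1 - s ^ 2) ^ β) (Icc 0 ρ) :=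
  ContinuousOn.rpow_const (by fun_prop) fun _ hs =>
    Or.inl (one_sub_sq_pos hs.1 (hs.2.trans_lt hρ)).ne'

theorem intervalIntegrable_deriv_mul {M W : ℝ → ℝ} {a b : ℝ} (hab : a ≤ b)
    (hM : MonotoneOn M (Icc a b)) (hW : ContinuousOn W (Icc a b)) :
    IntervalIntegrable (fun s => deriv M s * W s) volume a b := by
  rw [← uIcc_of_le hab] at hM hW
  exact hM.intervalIntegrable_deriv.mul_continuousOn hW

theorem integral_deriv_mul_of_monotoneOn {M W W' : ℝ → ℝ} {a b : ℝ} {S : Set ℝ} (hab : a ≤ b)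
    (hM : MonotoneOn M (Icc a b)) (hMc : ContinuousOn M (Icc a b)) (hS : S.Countable)
    (hMd : ∀ s ∈ Ioo a b \ S, DifferentiableAt ℝ M s) (hW : ContinuousOn W (Icc a b))
    (hWd : ∀ s ∈ Ioo a b, HasDerivAt W (W' s) s) (hW' : ContinuousOn W' (Icc a b)) :
    ∫ s in a..b, deriv M s * W s = M b * W b - M a * W a - ∫ s in a..b, M s * W' s := by
  have hM'W := intervalIntegrable_deriv_mul hab hM hW
  have hMW' : IntervalIntegrable (fun s => M s * W' s) volume a b :=
    (hMc.mul hW').intervalIntegrable_of_Icc hab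
  rw [eq_sub_iff_add_eq, ← intervalIntegral.integral_add hM'W hMW']
  exact integral_eq_of_hasDerivAt_off_countable_of_le (fun s => M s * W s) _ hab hS (hMc.mul hW)
    (fun s hs => (hMd s hs).hasDerivAt.mul (hWd s hs.1)) (hM'W.add hMW')

theorem setLIntegral_Ioo_ofReal {g : ℝ → ℝ} {a b : ℝ} (hab : a ≤ b)
    (hg : IntervalIntegrable g volume a b) (h0 : ∀ s ∈ Ioo a b, 0 ≤ g s) :
    ∫⁻ s in Ioo a b, ENNReal.ofReal (g s) = ENNReal.ofReal (∫ s in a..b, g s) := by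
  rw [intervalIntegral.integral_of_le hab, integral_Ioc_eq_integral_Ioo,
    ofReal_integral_eq_lintegral_ofReal
      ((intervalIntegrable_iff_integrableOn_Ioo_of_le hab).1 hg)
      ((ae_restrict_iff' measurableSet_Ioo).2 (.of_forall h0))]

/-- The part of `dirichletNormPow α p f` coming from the disc `|z| < ρ`. -/
noncomputable def truncNormPow (α p : ℝ) (f : ℂ → ℂ) (ρ : ℝ) : ENNReal :=
  ENNReal.ofReal (‖f 0‖ ^ p) +
    ∫⁻ r in Ioo (0 : ℝ) ρ, ENNReal.ofReal (deriv (integralMeanPow p f) r * (1 - r ^ 2) ^ (α - 1))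

/-- The density on `(0, 1)` against which `M_p^p(·, f)` is integrated once the derivative in
`dirichletNormPow α p f` has been removed by an integration by parts. -/
noncomputable def radialDensity (α s : ℝ) : ℝ :=
  2 * (α - 1) * s * (1 - s ^ 2) ^ (α - 2)

theorem hasDerivAt_one_sub_sq_rpow_sub_one (α : ℝ) {s : ℝ} (hs : 1 - s ^ 2 ≠ 0) :
    HasDerivAt (fun s : ℝ => (1 - s ^ 2) ^ (α - 1)) (-radialDensity α s) s := by
  simpa only [radialDensity, sub_sub, one_add_one_eq_two] using
    hasDerivAt_one_sub_sq_rpow (α - 1) hs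

theorem continuousOn_radialDensity (α : ℝ) {ρ : ℝ} (hρ : ρ < 1) :
    ContinuousOn (radialDensity α) (Icc 0 ρ) :=
  ContinuousOn.mul (by fun_prop) (continuousOn_one_sub_sq_rpow _ hρ)

theorem truncNormPow_eq (α : ℝ) {p ρ : ℝ} {f : ℂ → ℂ} (hp : 0 < p) (hρ0 : 0 < ρ) (hρ : ρ < 1)
    (hf : AnalyticOnNhd ℂ f (closedBall 0 ρ)) :
    truncNormPow α p f ρ = ENNReal.ofReal (integralMeanPow p f ρ * (1 - ρ ^ 2) ^ (α - 1)
      + ∫ s in 0..ρ, integralMeanPow p f s * radialDensity α s) := by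
  have hW : ContinuousOn (fun s : ℝ => (1 - s ^ 2) ^ (α - 1)) (Icc 0 ρ) :=
    continuousOn_one_sub_sq_rpow (α - 1) hρ
  have hmono := monotoneOn_integralMeanPow hp hf
  have hnonneg : ∀ s ∈ Ioo 0 ρ, 0 ≤ deriv (integralMeanPow p f) s * (1 - s ^ 2) ^ (α - 1) :=
    fun s hs => mul_nonneg (deriv_integralMeanPow_nonneg hp hf hs)
      (Real.rpow_nonneg (one_sub_sq_pos hs.1.le (hs.2.trans hρ)).le _)
  obtain ⟨S, hS, hdiff⟩ := exists_countable_differentiableAt_integralMeanPow hp hρ0 hf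
  have hparts := integral_deriv_mul_of_monotoneOn hρ0.le hmono
    (continuousOn_integralMeanPow hp hf) hS hdiff hW
    (fun s hs =>
      hasDerivAt_one_sub_sq_rpow_sub_one α (one_sub_sq_pos hs.1.le (hs.2.trans hρ)).ne')
    (continuousOn_radialDensity α hρ).neg
  have hint_nonneg : 0 ≤ ∫ s in 0..ρ, deriv (integralMeanPow p f) s * (1 - s ^ 2) ^ (α - 1) := by
    rw [intervalIntegral.integral_of_le hρ0.le, integral_Ioc_eq_integral_Ioo]
    exact setIntegral_nonneg measurableSet_Ioo hnonneg
  rw [truncNormPow, setLIntegral_Ioo_ofReal hρ0.le (intervalIntegrable_deriv_mul hρ0.le hmono hW)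
    hnonneg, ← ENNReal.ofReal_add (by positivity) hint_nonneg, hparts, integralMeanPow_zero]
  congr 1
  simp only [mul_neg, intervalIntegral.integral_neg, zero_pow two_ne_zero, sub_zero, Real.one_rpow]
  ring

theorem truncNormPow_one (α p : ℝ) (f : ℂ → ℂ) : truncNormPow α p f 1 = dirichletNormPow α p f :=
  rfl

theorem truncNormPow_mono (α p : ℝ) (f : ℂ → ℂ) : Monotone (truncNormPow α p f) :=
  fun _ _ h => add_le_add_right (lintegral_mono_set (Ioo_subset_Ioo_right h)) _

section Multichoose

variable {α : ℝ}

theorem succ_mul_multichoose_succ (α : ℝ) (n : ℕ) :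
    (n + 1) * Ring.multichoose α (n + 1) = (α + n) * Ring.multichoose α n := by
  have h := Ring.factorial_nsmul_multichoose_eq_ascPochhammer α (n + 1)
  rw [ascPochhammer_succ_right, Polynomial.smeval_mul,
    ← Ring.factorial_nsmul_multichoose_eq_ascPochhammer α n] at h
  simp only [Nat.factorial_succ, Polynomial.smeval_add, Polynomial.smeval_X,
    Polynomial.smeval_natCast, nsmul_eq_mul, pow_one, pow_zero, mul_one] at h
  push_cast at h
  refine mul_left_cancel₀ (Nat.cast_ne_zero.2 n.factorial_ne_zero : (n.factorial : ℝ) ≠ 0) ?_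
  linear_combination h

theorem multichoose_pos (hα : 0 < α) (n : ℕ) : 0 < Ring.multichoose α n := by
  induction n with
  | zero => simp
  | succ n ih =>
    refine pos_of_mul_pos_right (a := (n + 1 : ℝ)) ?_ (by positivity)
    rw [succ_mul_multichoose_succ]
    positivity

theorem hasSum_multichoose_mul_pow (α : ℝ) {x : ℂ} (hx : ‖x‖ < 1) :
    HasSum (fun n => ((Ring.multichoose α n : ℝ) : ℂ) * x ^ n) ((1 - x) ^ (-α : ℂ)) := by
  have h := (one_div_one_sub_cpow_hasFPowerSeriesOnBall_zero (α : ℂ)).hasSum (y := x)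
    (by simpa [enorm_eq_nnnorm, ← NNReal.coe_lt_coe] using hx)
  rw [zero_add, one_div, ← cpow_neg] at h
  refine h.congr_fun fun n => ?_
  simp [Ring.multichoose_eq, ofReal_choose, mul_comm]

theorem hasSum_multichoose_mul_pow_real (α : ℝ) {t : ℝ} (ht0 : 0 ≤ t) (ht : t < 1) :
    HasSum (fun n => Ring.multichoose α n * t ^ n) ((1 - t) ^ (-α)) := by
  have h := hasSum_multichoose_mul_pow α (x := (t : ℂ)) (by simpa [abs_of_nonneg ht0] using ht)
  rw [show (1 - (t : ℂ)) ^ (-α : ℂ) = (((1 - t) ^ (-α) : ℝ) : ℂ) by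
    rw [ofReal_cpow (by linarith)]; simp] at h
  exact_mod_cast h

end Multichoose

theorem intervalIntegrable_one_sub_sq_rpow {β : ℝ} (hβ : -1 < β) :
    IntervalIntegrable (fun s : ℝ => (1 - s ^ 2) ^ β) volume 0 1 := by
  have h : IntervalIntegrable (fun s : ℝ => (1 - s) ^ β) volume 0 1 := by
    simpa using
      ((intervalIntegral.intervalIntegrable_rpow' hβ (a := 0) (b := 1)).comp_sub_left 1).symm
  have hcont : ContinuousOn (fun s : ℝ => (1 + s) ^ β) (uIcc 0 1) := by
    refine ContinuousOn.rpow_const (by fun_prop) fun s hs => Or.inl ?_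
    rw [uIcc_of_le zero_le_one] at hs
    linarith [hs.1]
  refine (h.mul_continuousOn hcont).congr fun s hs => ?_
  rw [uIoc_of_le zero_le_one] at hs
  rw [← Real.mul_rpow (by linarith [hs.2]) (by linarith [hs.1])]
  ring_nf

/-- The squared norm of the monomial `zⁿ` in the truncated norm with `p = 2`. -/
noncomputable def coeffWeight (α ρ : ℝ) (n : ℕ) : ℝ :=
  (if n = 0 then 1 else 0) + ∫ s in 0..ρ, 2 * n * s ^ (2 * n - 1) * (1 - s ^ 2) ^ (α - 1)

section CoeffWeight

variable {α ρ : ℝ}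

theorem intervalIntegrable_pow_mul_one_sub_sq_rpow (hα : 0 < α) (hρ0 : 0 ≤ ρ) (hρ : ρ ≤ 1)
    (x : ℝ) (k : ℕ) :
    IntervalIntegrable (fun s : ℝ => x * s ^ k * (1 - s ^ 2) ^ (α - 1)) volume 0 ρ :=
  ((intervalIntegrable_one_sub_sq_rpow (by linarith)).continuousOn_mul
    (Continuous.continuousOn (by fun_prop))).mono_set (by
      rw [uIcc_of_le hρ0, uIcc_of_le zero_le_one]
      exact Icc_subset_Icc_right hρ)

theorem coeffWeight_one_succ (hα : 0 < α) (n : ℕ) :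
    (α + n) * coeffWeight α 1 (n + 1) = (n + 1) * coeffWeight α 1 n := by
  have hi := intervalIntegrable_pow_mul_one_sub_sq_rpow hα zero_le_one le_rfl
  have hftc := integral_eq_of_hasDerivAt_off_countable_of_le
    (fun s : ℝ => s ^ (2 * n) * (1 - s ^ 2) ^ α)
    (fun s => 2 * n * s ^ (2 * n - 1) * (1 - s ^ 2) ^ (α - 1)
      - 2 * (α + n) * s ^ (2 * n + 1) * (1 - s ^ 2) ^ (α - 1))
    zero_le_one countable_empty
    (ContinuousOn.mul (by fun_prop) (ContinuousOn.rpow_const (by fun_prop) fun _ _ => Or.inr hα.le))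
    (fun s hs => by
      have hpos := one_sub_sq_pos hs.1.1.le hs.1.2
      refine ((hasDerivAt_pow (2 * n) s).mul
        (hasDerivAt_one_sub_sq_rpow α hpos.ne')).congr_deriv ?_
      have hsplit : (1 - s ^ 2) ^ α = (1 - s ^ 2) ^ (α - 1) * (1 - s ^ 2) := by
        rw [← Real.rpow_add_one hpos.ne', sub_add_cancel]
      rcases n with _ | n
      · simp
      · rw [hsplit, show 2 * (n + 1) - 1 = 2 * n + 1 by omega]
        push_cast
        ring)
    ((hi _ _).sub (hi _ _))
  rw [intervalIntegral.integral_sub (hi _ _) (hi _ _)] at hftc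
  simp only [coeffWeight, Nat.add_eq_zero_iff, one_ne_zero, and_false, if_false, zero_add,
    show 2 * (n + 1) - 1 = 2 * n + 1 by omega, mul_assoc, intervalIntegral.integral_const_mul]
    at hftc ⊢
  have h0 : (0 : ℝ) ^ (2 * n) = if n = 0 then 1 else 0 := by simp [zero_pow_eq]
  simp only [one_pow, sub_self, Real.zero_rpow hα.ne', h0, zero_pow two_ne_zero, sub_zero,
    Real.one_rpow, mul_one, mul_zero, zero_sub] at hftc
  push_cast
  linear_combination (-(n + 1) : ℝ) * hftc

theorem coeffWeight_one (hα : 0 < α) (n : ℕ) : coeffWeight α 1 n = (Ring.multichoose α n)⁻¹ := by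
  refine eq_inv_of_mul_eq_one_left ?_
  induction n with
  | zero => simp [coeffWeight]
  | succ n ih =>
    refine mul_left_cancel₀ (by positivity : (α + n) * (n + 1 : ℝ) ≠ 0) ?_
    linear_combination (Ring.multichoose α (n + 1) * (n + 1)) * coeffWeight_one_succ hα n
      + (n + 1) * coeffWeight α 1 n * succ_mul_multichoose_succ α n + (α + n) * (n + 1) * ih

theorem pow_le_coeffWeight (hα : 0 < α) (hα1 : α ≤ 1) (hρ0 : 0 ≤ ρ) (hρ : ρ ≤ 1) (n : ℕ) :
    ρ ^ (2 * n) ≤ coeffWeight α ρ n := by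
  have hcont : Continuous fun s : ℝ => 2 * n * s ^ (2 * n - 1) := by fun_prop
  have hftc : ∫ s in 0..ρ, 2 * n * s ^ (2 * n - 1) = ρ ^ (2 * n) - 0 ^ (2 * n) :=
    intervalIntegral.integral_eq_sub_of_hasDerivAt (f := fun s => s ^ (2 * n))
      (fun s _ => by simpa using hasDerivAt_pow (2 * n) s) (hcont.intervalIntegrable 0 ρ)
  have hmono : ∫ s in 0..ρ, 2 * n * s ^ (2 * n - 1)
      ≤ ∫ s in 0..ρ, 2 * n * s ^ (2 * n - 1) * (1 - s ^ 2) ^ (α - 1) := by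
    refine intervalIntegral.integral_mono_on_of_le_Ioo hρ0 (hcont.intervalIntegrable 0 ρ)
      (intervalIntegrable_pow_mul_one_sub_sq_rpow hα hρ0 hρ _ _) fun s hs => ?_
    have hs0 := hs.1.le
    exact le_mul_of_one_le_right (by positivity) (Real.one_le_rpow_of_pos_of_le_one_of_nonpos
      (one_sub_sq_pos hs0 (hs.2.trans_le hρ)) (by nlinarith) (by linarith))
  have h0 : (0 : ℝ) ^ (2 * n) = if n = 0 then 1 else 0 := by simp [zero_pow_eq]
  rw [coeffWeight, ← h0]
  linarith

theorem coeffWeight_pos (hα : 0 < α) (hα1 : α ≤ 1) (hρ0 : 0 < ρ) (hρ : ρ ≤ 1) (n : ℕ) :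
    0 < coeffWeight α ρ n :=
  (pow_pos hρ0 _).trans_le (pow_le_coeffWeight hα hα1 hρ0.le hρ n)

theorem tendsto_coeffWeight (hα : 0 < α) (n : ℕ) :
    Tendsto (fun ρ => coeffWeight α ρ n) (𝓝[<] 1) (𝓝 (Ring.multichoose α n)⁻¹) := by
  rw [← coeffWeight_one hα]
  have hcont := intervalIntegral.continuousOn_primitive_interval'
    (intervalIntegrable_pow_mul_one_sub_sq_rpow hα zero_le_one le_rfl (2 * n) (2 * n - 1))
    left_mem_uIcc
  rw [uIcc_of_le zero_le_one] at hcont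
  exact (((hcont 1 (right_mem_Icc.2 zero_le_one)).mono_of_mem_nhdsWithin
    (Icc_mem_nhdsLT one_pos)).tendsto).const_add _

theorem ofReal_coeffWeight (hα : 0 < α) (hρ0 : 0 ≤ ρ) (hρ : ρ ≤ 1) (n : ℕ) :
    ENNReal.ofReal (coeffWeight α ρ n) = (if n = 0 then 1 else 0) + ∫⁻ s in Ioo 0 ρ,
      ENNReal.ofReal (2 * n * s ^ (2 * n - 1) * (1 - s ^ 2) ^ (α - 1)) := by
  have hnonneg : ∀ s ∈ Ioo 0 ρ, 0 ≤ 2 * n * s ^ (2 * n - 1) * (1 - s ^ 2) ^ (α - 1) :=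
    fun s hs => by
      have := hs.1
      have := one_sub_sq_pos hs.1.le (hs.2.trans_le hρ)
      positivity
  rw [setLIntegral_Ioo_ofReal hρ0 (intervalIntegrable_pow_mul_one_sub_sq_rpow hα hρ0 hρ _ _)
    hnonneg, coeffWeight, ENNReal.ofReal_add (by positivity)]
  · split_ifs <;> simp
  · rw [intervalIntegral.integral_of_le hρ0, integral_Ioc_eq_integral_Ioo]
    exact setIntegral_nonneg measurableSet_Ioo hnonneg

end CoeffWeight

section TermwiseDerivative

variable {A : ℕ → ℝ} {ρ s t u : ℝ}

theorem summable_mul_pow_pred (ht : 0 < t) (htu : t < u)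
    (hA : Summable fun n => A n * u ^ (2 * n)) :
    Summable fun n => A n * (2 * n * t ^ (2 * n - 1)) := by
  have hu : 0 < u := ht.trans htu
  have hratio : Tendsto (fun n : ℕ => 2 / t * (n * ((t / u) ^ 2) ^ n)) atTop (𝓝 (2 / t * 0)) :=
    (tendsto_self_mul_const_pow_of_lt_one (by positivity)
      ((sq_lt_one_iff₀ (by positivity)).2 ((div_lt_one hu).2 htu))).const_mul _
  refine summable_of_isBigO_nat hA ?_
  refine ((Asymptotics.isBigO_refl (fun n => A n * u ^ (2 * n)) atTop).mul
    (hratio.isBigO_one ℝ)).congr (fun n => ?_) fun n => mul_one _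
  rcases n with _ | n
  · simp
  · rw [← pow_mul, div_pow, show 2 * (n + 1) - 1 = 2 * n + 1 by omega,
      show 2 * (n + 1) = 2 * n + 1 + 1 by ring, pow_succ t]
    field_simp

theorem hasDerivAt_tsum_mul_pow (hA0 : ∀ n, 0 ≤ A n)
    (hA : ∀ t ∈ Ico 0 ρ, Summable fun n => A n * t ^ (2 * n)) (hs : s ∈ Ioo 0 ρ) :
    HasDerivAt (fun t => ∑' n, A n * t ^ (2 * n)) (∑' n, A n * (2 * n * s ^ (2 * n - 1))) s := by
  obtain ⟨t, hst, htρ⟩ := exists_between hs.2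
  obtain ⟨u, htu, huρ⟩ := exists_between htρ
  have ht0 : 0 < t := hs.1.trans hst
  refine hasDerivAt_tsum_of_isPreconnected (g := fun n y => A n * y ^ (2 * n))
    (g' := fun n y => A n * (2 * n * y ^ (2 * n - 1))) (t := Ioo 0 t)
    (summable_mul_pow_pred ht0 htu (hA u ⟨(ht0.trans htu).le, huρ⟩)) isOpen_Ioo isPreconnected_Ioo
    (fun n y _ => ?_) (fun n y hy => ?_) ⟨hs.1, hst⟩ (hA s ⟨hs.1.le, hs.2⟩) ⟨hs.1, hst⟩
  · simpa using (hasDerivAt_pow (2 * n) y).const_mul (A n)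
  · have hy0 := hy.1
    have hyt := hy.2.le
    have hAn := hA0 n
    rw [Real.norm_of_nonneg (by positivity)]
    gcongr

end TermwiseDerivative

theorem IsHalfPowerSeries.truncNormPow_eq_tsum {α p ρ : ℝ} {f : ℂ → ℂ} {a : ℕ → ℂ} (hα : 0 < α)
    (h : IsHalfPowerSeries p ρ f a) (hρ0 : 0 < ρ) (hρ : ρ ≤ 1) :
    truncNormPow α p f ρ = ∑' n, ENNReal.ofReal (coeffWeight α ρ n * ‖a n‖ ^ 2) := by
  have hsum : ∀ s ∈ Ico 0 ρ, Summable fun n => ‖a n‖ ^ 2 * s ^ (2 * n) :=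
    fun s hs => h.summable_norm_sq_mul_pow hs
  have hderiv : ∀ s ∈ Ioo 0 ρ, deriv (integralMeanPow p f) s
      = ∑' n, ‖a n‖ ^ 2 * (2 * n * s ^ (2 * n - 1)) := fun s hs => by
    refine ((hasDerivAt_tsum_mul_pow (fun n => by positivity) hsum hs).congr_of_eventuallyEq
      ?_).deriv
    filter_upwards [Ioo_mem_nhds hs.1 hs.2] with t ht
    exact h.integralMeanPow_eq_tsum (Ioo_subset_Ico_self ht)
  have hintegrand : ∀ s ∈ Ioo 0 ρ,
      ENNReal.ofReal (deriv (integralMeanPow p f) s * (1 - s ^ 2) ^ (α - 1))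
      = ∑' n : ℕ, ENNReal.ofReal (‖a n‖ ^ 2) *
          ENNReal.ofReal (2 * n * s ^ (2 * n - 1) * (1 - s ^ 2) ^ (α - 1)) := fun s hs => by
    have hs0 := hs.1.le
    have hs1 := one_sub_sq_pos hs0 (hs.2.trans_le hρ)
    obtain ⟨u, hsu, huρ⟩ := exists_between hs.2
    rw [hderiv s hs, ← tsum_mul_right, ENNReal.ofReal_tsum_of_nonneg (fun n => by positivity)
      ((summable_mul_pow_pred hs.1 hsu (hsum u ⟨hs0.trans hsu.le, huρ⟩)).mul_right _)]
    refine tsum_congr fun n => ?_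
    rw [← ENNReal.ofReal_mul (by positivity), mul_assoc]
  have hzero : ENNReal.ofReal (‖f 0‖ ^ p)
      = ∑' n, ENNReal.ofReal (‖a n‖ ^ 2) * if n = 0 then 1 else 0 := by
    rw [h.norm_rpow_eq 0 (mem_ball_self hρ0), tsum_eq_single 0 fun n hn => by simp [hn],
      tsum_eq_single 0 fun n hn => by simp [hn]]
    simp
  rw [truncNormPow, setLIntegral_congr_fun measurableSet_Ioo hintegrand,
    lintegral_tsum fun n => by fun_prop, hzero, ← ENNReal.tsum_add]
  refine tsum_congr fun n => ?_
  rw [lintegral_const_mul _ (by fun_prop), ← mul_add, ← ofReal_coeffWeight hα hρ0.le hρ,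
    ← ENNReal.ofReal_mul (by positivity), mul_comm]

theorem IsHalfPowerSeries.dirichletNormPow_eq_tsum {α p : ℝ} {f : ℂ → ℂ} {a : ℕ → ℂ} (hα : 0 < α)
    (h : IsHalfPowerSeries p 1 f a) :
    dirichletNormPow α p f = ∑' n, ENNReal.ofReal ((Ring.multichoose α n)⁻¹ * ‖a n‖ ^ 2) := by
  simp only [← truncNormPow_one, h.truncNormPow_eq_tsum hα one_pos le_rfl, coeffWeight_one hα]

section WeightedCauchySchwarz

variable {ι : Type*} {a e : ι → ℂ} {c : ι → ℝ} {H : ℂ} {K : ℝ}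

theorem mul_norm_sub_div_sq (a e l : ℂ) {c : ℝ} (hc : 0 < c) :
    c * ‖a - l * conj e / c‖ ^ 2
      = c * ‖a‖ ^ 2 - 2 * (conj l * (a * e)).re + ‖l‖ ^ 2 * (‖e‖ ^ 2 / c) := by
  have hinner : (a * conj (l * conj e / c)).re = (conj l * (a * e)).re / c := by
    rw [← div_ofReal_re]
    congr 1
    simp only [map_div₀, map_mul, conj_conj, conj_ofReal]
    ring
  have hnorm : ‖l * conj e / c‖ ^ 2 = ‖l‖ ^ 2 * ‖e‖ ^ 2 / c ^ 2 := by
    simp [div_pow, mul_pow]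
  rw [← normSq_eq_norm_sq, normSq_sub, hinner, normSq_eq_norm_sq, normSq_eq_norm_sq, hnorm]
  field_simp
  ring

theorem hasSum_mul_norm_sub_sq (hc : ∀ i, 0 < c i) (hH : HasSum (fun i => a i * e i) H)
    (hK : HasSum (fun i => ‖e i‖ ^ 2 / c i) K) (hK0 : 0 < K)
    (ha : Summable fun i => c i * ‖a i‖ ^ 2) :
    HasSum (fun i => c i * ‖a i - H / K * conj (e i) / c i‖ ^ 2)
      (∑' i, c i * ‖a i‖ ^ 2 - ‖H‖ ^ 2 / K) := by
  have hcross := (hasSum_re (hH.mul_left (conj (H / K)))).mul_left 2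
  have hsum := (ha.hasSum.sub hcross).add (hK.mul_left (‖H / K‖ ^ 2))
  have hconj : conj (H / K) * H = ((‖H‖ ^ 2 / K : ℝ) : ℂ) := by
    rw [map_div₀, conj_ofReal, div_mul_eq_mul_div, conj_mul']
    push_cast
    rfl
  have hvalue : ∑' i, c i * ‖a i‖ ^ 2 - 2 * (conj (H / K) * H).re + ‖H / K‖ ^ 2 * K
      = ∑' i, c i * ‖a i‖ ^ 2 - ‖H‖ ^ 2 / K := by
    rw [hconj, ofReal_re, norm_div, norm_real, Real.norm_of_nonneg hK0.le]
    field_simp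
    ring
  rw [hvalue] at hsum
  exact hsum.congr_fun fun i => mul_norm_sub_div_sq _ _ _ (hc i)

theorem summable_of_tsum_ofReal_ne_top {x : ι → ℝ} (hx : ∀ i, 0 ≤ x i)
    (h : ∑' i, ENNReal.ofReal (x i) ≠ ⊤) : Summable x :=
  (ENNReal.summable_toReal h).congr fun i => ENNReal.toReal_ofReal (hx i)

theorem ofReal_norm_sq_div_le_tsum (hc : ∀ i, 0 < c i) (hH : HasSum (fun i => a i * e i) H)
    (hK : HasSum (fun i => ‖e i‖ ^ 2 / c i) K) (hK0 : 0 < K) :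
    ENNReal.ofReal (‖H‖ ^ 2 / K) ≤ ∑' i, ENNReal.ofReal (c i * ‖a i‖ ^ 2) := by
  have hnonneg : ∀ b : ι → ℂ, ∀ i, 0 ≤ c i * ‖b i‖ ^ 2 := fun b i =>
    mul_nonneg (hc i).le (by positivity)
  by_cases htop : ∑' i, ENNReal.ofReal (c i * ‖a i‖ ^ 2) = ⊤
  · exact htop ▸ le_top
  have ha := summable_of_tsum_ofReal_ne_top (hnonneg a) htop
  rw [← ENNReal.ofReal_tsum_of_nonneg (hnonneg a) ha]
  exact ENNReal.ofReal_le_ofReal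
    (sub_nonneg.1 ((hasSum_mul_norm_sub_sq hc hH hK hK0 ha).nonneg (hnonneg _)))

theorem eq_of_ofReal_norm_sq_div_eq_tsum (hc : ∀ i, 0 < c i) (hH : HasSum (fun i => a i * e i) H)
    (hK : HasSum (fun i => ‖e i‖ ^ 2 / c i) K) (hK0 : 0 < K)
    (heq : ENNReal.ofReal (‖H‖ ^ 2 / K) = ∑' i, ENNReal.ofReal (c i * ‖a i‖ ^ 2)) (i : ι) :
    a i = H / K * conj (e i) / c i := by
  have hnonneg : ∀ b : ι → ℂ, ∀ i, 0 ≤ c i * ‖b i‖ ^ 2 := fun b i =>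
    mul_nonneg (hc i).le (by positivity)
  have ha := summable_of_tsum_ofReal_ne_top (hnonneg a) (heq ▸ ENNReal.ofReal_ne_top)
  rw [← ENNReal.ofReal_tsum_of_nonneg (hnonneg a) ha,
    ENNReal.ofReal_eq_ofReal_iff (by positivity) (tsum_nonneg (hnonneg a))] at heq
  have hdist := hasSum_mul_norm_sub_sq hc hH hK hK0 ha
  rw [← heq, sub_self, hasSum_zero_iff_of_nonneg (hnonneg _)] at hdist
  simpa [(hc i).ne', sub_eq_zero] using congrFun hdist i

end WeightedCauchySchwarz

section TruncatedKernel

variable {α ρ r : ℝ} {w : ℂ}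

theorem one_sub_norm_sq_pos (hw : w ∈ ball (0 : ℂ) 1) : 0 < 1 - ‖w‖ ^ 2 :=
  one_sub_sq_pos (norm_nonneg w) (mem_ball_zero_iff.1 hw)

/-- The diagonal value at `w` of the reproducing kernel of the Hilbert space of power series
normed by `∑ coeffWeight α ρ n * ‖aₙ‖²`. -/
noncomputable def truncKernel (α ρ : ℝ) (w : ℂ) : ℝ :=
  ∑' n : ℕ, ‖w ^ n‖ ^ 2 / coeffWeight α ρ n

theorem norm_pow_sq_div_coeffWeight_le (hα : 0 < α) (hα1 : α ≤ 1) (hr0 : 0 < r) (hr : r ≤ ρ)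
    (hρ : ρ ≤ 1) (w : ℂ) (n : ℕ) :
    ‖w ^ n‖ ^ 2 / coeffWeight α ρ n ≤ ((‖w‖ / r) ^ 2) ^ n := by
  have hle : r ^ (2 * n) ≤ coeffWeight α ρ n :=
    (pow_le_pow_left₀ hr0.le hr _).trans (pow_le_coeffWeight hα hα1 (hr0.le.trans hr) hρ n)
  rw [norm_pow, ← pow_mul, ← pow_mul, mul_comm n, div_pow]
  gcongr

theorem summable_norm_div_sq_pow (hw : w ∈ ball (0 : ℂ) r) :
    Summable fun n : ℕ => ((‖w‖ / r) ^ 2) ^ n := by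
  have hr : 0 < r := pos_of_mem_ball hw
  refine summable_geometric_of_lt_one (by positivity) ((sq_lt_one_iff₀ (by positivity)).2 ?_)
  exact (div_lt_one hr).2 (mem_ball_zero_iff.1 hw)

theorem hasSum_truncKernel (hα : 0 < α) (hα1 : α ≤ 1) (hρ : ρ ≤ 1) (hw : w ∈ ball (0 : ℂ) ρ) :
    HasSum (fun n => ‖w ^ n‖ ^ 2 / coeffWeight α ρ n) (truncKernel α ρ w) := by
  have hρ0 : 0 < ρ := pos_of_mem_ball hw
  refine (Summable.of_nonneg_of_le (fun n => ?_)
    (norm_pow_sq_div_coeffWeight_le hα hα1 hρ0 le_rfl hρ w) (summable_norm_div_sq_pow hw)).hasSum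
  have := coeffWeight_pos hα hα1 hρ0 hρ n
  positivity

theorem truncKernel_pos (hα : 0 < α) (hα1 : α ≤ 1) (hρ : ρ ≤ 1) (hw : w ∈ ball (0 : ℂ) ρ) :
    0 < truncKernel α ρ w := by
  have hpos := coeffWeight_pos hα hα1 (pos_of_mem_ball hw) hρ
  refine (hasSum_truncKernel hα hα1 hρ hw).summable.tsum_pos (fun n => ?_) 0 ?_
  · have := hpos n
    positivity
  · simpa using hpos 0

theorem hasSum_norm_pow_sq_div_inv_multichoose (α : ℝ) (hw : w ∈ ball (0 : ℂ) 1) :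
    HasSum (fun n => ‖w ^ n‖ ^ 2 / (Ring.multichoose α n)⁻¹) ((1 - ‖w‖ ^ 2) ^ (-α)) := by
  refine (hasSum_multichoose_mul_pow_real α (sq_nonneg ‖w‖)
    (sub_pos.1 (one_sub_norm_sq_pos hw))).congr_fun fun n => ?_
  rw [div_inv_eq_mul, norm_pow, ← pow_mul, ← pow_mul, mul_comm n, mul_comm]

theorem tendsto_truncKernel (hα : 0 < α) (hα1 : α ≤ 1) (hw : w ∈ ball (0 : ℂ) 1) :
    Tendsto (fun ρ => truncKernel α ρ w) (𝓝[<] 1) (𝓝 ((1 - ‖w‖ ^ 2) ^ (-α))) := by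
  rw [← (hasSum_norm_pow_sq_div_inv_multichoose α hw).tsum_eq]
  obtain ⟨r, hwr, hr1⟩ := exists_between (mem_ball_zero_iff.1 hw)
  have hr0 : 0 < r := (norm_nonneg w).trans_lt hwr
  refine tendsto_tsum_of_dominated_convergence
    (summable_norm_div_sq_pow (mem_ball_zero_iff.2 hwr)) (fun n => ?_) ?_
  · exact tendsto_const_nhds.div (tendsto_coeffWeight hα n) (inv_ne_zero (multichoose_pos hα n).ne')
  · filter_upwards [Ioo_mem_nhdsLT hr1] with ρ hρ n
    have := coeffWeight_pos hα hα1 (hr0.trans hρ.1) hρ.2.le n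
    rw [Real.norm_of_nonneg (by positivity)]
    exact norm_pow_sq_div_coeffWeight_le hα hα1 hr0 hρ.1.le hρ.2.le w n

end TruncatedKernel

section BoundOfLeOne

variable {α p ρ : ℝ} {f g : ℂ → ℂ} {a : ℕ → ℂ} {w : ℂ}

theorem IsHalfPowerSeries.ofReal_div_truncKernel_le (h : IsHalfPowerSeries p ρ f a) (hα : 0 < α)
    (hα1 : α ≤ 1) (hρ : ρ ≤ 1) (hw : w ∈ ball (0 : ℂ) ρ) :
    ENNReal.ofReal (‖f w‖ ^ p / truncKernel α ρ w) ≤ truncNormPow α p f ρ := by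
  have hρ0 : 0 < ρ := pos_of_mem_ball hw
  rw [h.truncNormPow_eq_tsum hα hρ0 hρ, h.norm_rpow_eq w hw]
  exact ofReal_norm_sq_div_le_tsum (coeffWeight_pos hα hα1 hρ0 hρ) (h.summable w hw).hasSum
    (hasSum_truncKernel hα hα1 hρ hw) (truncKernel_pos hα hα1 hρ hw)

theorem IsZeroFreeMajorant.truncNormPow_le (h : IsZeroFreeMajorant ρ f g) (hα1 : α ≤ 1)
    (hp : 0 < p) (hρ0 : 0 < ρ) (hρ : ρ < 1) (hf : AnalyticOnNhd ℂ f (closedBall 0 ρ)) :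
    truncNormPow α p g ρ ≤ truncNormPow α p f ρ := by
  have hint : ∀ {k : ℂ → ℂ}, AnalyticOnNhd ℂ k (closedBall 0 ρ) →
      IntervalIntegrable (fun s => integralMeanPow p k s * radialDensity α s) volume 0 ρ :=
    fun hk => ((continuousOn_integralMeanPow hp hk).mul
      (continuousOn_radialDensity α hρ)).intervalIntegrable_of_Icc hρ0.le
  rw [truncNormPow_eq α hp hρ0 hρ hf, truncNormPow_eq α hp hρ0 hρ h.analyticOnNhd,
    integralMeanPow_congr_of_norm_eq hρ0.le h.norm_eq_of_mem_sphere]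
  refine ENNReal.ofReal_le_ofReal (add_le_add_right
    (intervalIntegral.integral_mono_on hρ0.le (hint h.analyticOnNhd) (hint hf) fun s hs => ?_) _)
  have hsphere : sphere (0 : ℂ) s ⊆ closedBall 0 ρ :=
    sphere_subset_closedBall.trans (closedBall_subset_closedBall hs.2)
  refine mul_le_mul_of_nonpos_right (integralMeanPow_le_of_norm_le hp hs.1 (hf.mono hsphere)
    (h.analyticOnNhd.mono hsphere) fun z hz => h.norm_le z (hsphere hz)) ?_
  exact mul_nonpos_of_nonpos_of_nonneg
    (mul_nonpos_of_nonpos_of_nonneg (by linarith) hs.1)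
    (Real.rpow_nonneg (one_sub_sq_pos hs.1 (hs.2.trans_lt hρ)).le _)

theorem IsZeroFreeMajorant.ofReal_div_truncKernel_le (h : IsZeroFreeMajorant ρ f g) (hα : 0 < α)
    (hα1 : α ≤ 1) (hp : 0 < p) (hρ : ρ < 1) (hf : AnalyticOnNhd ℂ f (closedBall 0 ρ))
    (hw : w ∈ ball (0 : ℂ) ρ) :
    ENNReal.ofReal (‖g w‖ ^ p / truncKernel α ρ w) ≤ truncNormPow α p f ρ := by
  obtain ⟨a, ha⟩ := exists_isHalfPowerSeries p (h.analyticOnNhd.mono ball_subset_closedBall)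
    h.ne_zero
  exact (ha.ofReal_div_truncKernel_le hα hα1 hρ.le hw).trans
    (h.truncNormPow_le hα1 hp (pos_of_mem_ball hw) hρ hf)

theorem ofReal_mul_rpow_le_dirichletNormPow_of_majorant (hα : 0 < α) (hα1 : α ≤ 1) (hp : 0 < p)
    (hf : AnalyticOnNhd ℂ f (ball 0 1)) (hw : w ∈ ball (0 : ℂ) 1) (hfw : f w ≠ 0) {u : ℝ → ℝ}
    {y : ℝ} (hu : Tendsto u (𝓝[<] 1) (𝓝 y))
    (hle : ∀ᶠ ρ in 𝓝[<] 1, ∀ g, IsZeroFreeMajorant ρ f g → u ρ ≤ ‖g w‖ ^ p) :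
    ENNReal.ofReal (y * (1 - ‖w‖ ^ 2) ^ α) ≤ dirichletNormPow α p f := by
  have hpos := one_sub_norm_sq_pos hw
  have hlim := ENNReal.tendsto_ofReal (hu.div (tendsto_truncKernel hα hα1 hw) (by positivity))
  rw [Real.rpow_neg hpos.le, div_inv_eq_mul] at hlim
  refine le_of_tendsto hlim ?_
  filter_upwards [hle, Ioo_mem_nhdsLT (mem_ball_zero_iff.1 hw)] with ρ hg ⟨hwρ, hρ⟩
  have hwρ : w ∈ ball (0 : ℂ) ρ := mem_ball_zero_iff.2 hwρ
  have hfρ := hf.mono (closedBall_subset_ball hρ : closedBall (0 : ℂ) ρ ⊆ ball 0 1)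
  obtain ⟨g, h⟩ := exists_isZeroFreeMajorant (pos_of_mem_ball hwρ) hfρ
    ⟨w, ball_subset_closedBall hwρ, hfw⟩
  calc ENNReal.ofReal (u ρ / truncKernel α ρ w)
      ≤ ENNReal.ofReal (‖g w‖ ^ p / truncKernel α ρ w) := by
        have := truncKernel_pos hα hα1 hρ.le hwρ
        have := hg g h
        gcongr
    _ ≤ truncNormPow α p f ρ := h.ofReal_div_truncKernel_le hα hα1 hp hρ hfρ hwρ
    _ ≤ dirichletNormPow α p f := truncNormPow_mono α p f hρ.le

theorem ofReal_norm_rpow_mul_le_dirichletNormPow_of_le_one (hα : 0 < α) (hα1 : α ≤ 1) (hp : 0 < p)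
    (hf : AnalyticOnNhd ℂ f (ball 0 1)) (hw : w ∈ ball (0 : ℂ) 1) :
    ENNReal.ofReal (‖f w‖ ^ p * (1 - ‖w‖ ^ 2) ^ α) ≤ dirichletNormPow α p f := by
  by_cases hfw : f w = 0
  · simp [hfw, Real.zero_rpow hp.ne']
  refine ofReal_mul_rpow_le_dirichletNormPow_of_majorant hα hα1 hp hf hw hfw tendsto_const_nhds ?_
  filter_upwards [Ioo_mem_nhdsLT (mem_ball_zero_iff.1 hw)] with ρ hρ g hg
  have := hg.norm_le w (mem_closedBall_zero_iff.2 hρ.1.le)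
  gcongr

theorem ofReal_norm_mul_canonicalFactor_rpow_mul_le_dirichletNormPow (hα : 0 < α) (hα1 : α ≤ 1)
    (hp : 0 < p) (hf : AnalyticOnNhd ℂ f (ball 0 1)) (hw : w ∈ ball (0 : ℂ) 1) (hfw : f w ≠ 0)
    {b : ℂ} (hb : b ∈ ball (0 : ℂ) 1) (hfb : f b = 0) :
    ENNReal.ofReal ((‖f w‖ * ‖canonicalFactor 1 b w‖) ^ p * (1 - ‖w‖ ^ 2) ^ α)
      ≤ dirichletNormPow α p f := by
  have hwb : w - b ≠ 0 := sub_ne_zero.2 fun h => hfw (h ▸ hfb)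
  have hcont : ContinuousAt (fun ρ : ℝ => (‖f w‖ * ‖canonicalFactor ρ b w‖) ^ p) 1 := by
    simp only [canonicalFactor_apply]
    refine (continuousAt_const.mul (ContinuousAt.norm (ContinuousAt.div (by fun_prop)
      (by fun_prop) ?_))).rpow_const (Or.inr hp.le)
    simpa using hwb
  refine ofReal_mul_rpow_le_dirichletNormPow_of_majorant hα hα1 hp hf hw hfw
    (hcont.tendsto.mono_left nhdsWithin_le_nhds) ?_
  filter_upwards [Ioo_mem_nhdsLT (mem_ball_zero_iff.1 hw),
    Ioo_mem_nhdsLT (mem_ball_zero_iff.1 hb)] with ρ hwρ hbρ g hg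
  have := hg.norm_mul_canonicalFactor_le b (mem_ball_zero_iff.2 hbρ.1) hfb w
    (mem_closedBall_zero_iff.2 hwρ.1.le)
  gcongr

end BoundOfLeOne

section KernelPow

variable {α β p : ℝ} {f : ℂ → ℂ} {w z C : ℂ}

/-- The principal power `(1 - w̄z) ^ β`; the extremal functions for evaluation at `w` are the
multiples of `kernelPow (-2α/p) w`. -/
noncomputable def kernelPow (β : ℝ) (w z : ℂ) : ℂ :=
  (1 - conj w * z) ^ (β : ℂ)

theorem norm_conj_mul_lt_one (hw : w ∈ ball (0 : ℂ) 1) (hz : z ∈ ball (0 : ℂ) 1) :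
    ‖conj w * z‖ < 1 := by
  rw [mem_ball_zero_iff] at hw hz
  rw [norm_mul, norm_conj]
  exact mul_lt_one_of_nonneg_of_lt_one_left (norm_nonneg w) hw hz.le

theorem one_sub_conj_mul_mem_slitPlane (hw : w ∈ ball (0 : ℂ) 1) (hz : z ∈ ball (0 : ℂ) 1) :
    1 - conj w * z ∈ slitPlane := by
  simpa [sub_eq_add_neg] using mem_slitPlane_of_norm_lt_one
    ((norm_neg _).trans_lt (norm_conj_mul_lt_one hw hz))

theorem one_sub_conj_mul_ne_zero (hw : w ∈ ball (0 : ℂ) 1) (hz : z ∈ ball (0 : ℂ) 1) :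
    1 - conj w * z ≠ 0 :=
  slitPlane_ne_zero (one_sub_conj_mul_mem_slitPlane hw hz)

theorem norm_kernelPow (β : ℝ) (w z : ℂ) : ‖kernelPow β w z‖ = ‖1 - conj w * z‖ ^ β :=
  norm_cpow_real _ _

theorem norm_one_sub_conj_mul_self (hw : w ∈ ball (0 : ℂ) 1) :
    ‖1 - conj w * w‖ = 1 - ‖w‖ ^ 2 := by
  rw [conj_mul', ← ofReal_pow, ← ofReal_one, ← ofReal_sub, norm_real,
    Real.norm_of_nonneg (one_sub_norm_sq_pos hw).le]

theorem norm_kernelPow_self (β : ℝ) (hw : w ∈ ball (0 : ℂ) 1) :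
    ‖kernelPow β w w‖ = (1 - ‖w‖ ^ 2) ^ β := by
  rw [norm_kernelPow, norm_one_sub_conj_mul_self hw]

theorem norm_kernelPow_rpow (α : ℝ) (hp : p ≠ 0) (w z : ℂ) :
    ‖kernelPow (-2 * α / p) w z‖ ^ p = ‖kernelPow (-α) w z‖ ^ 2 := by
  rw [norm_kernelPow, norm_kernelPow, ← Real.rpow_mul (norm_nonneg _),
    ← Real.rpow_mul_natCast (norm_nonneg _)]
  congr 1
  field_simp
  push_cast
  ring

theorem kernelPow_ne_zero (β : ℝ) (hw : w ∈ ball (0 : ℂ) 1) (hz : z ∈ ball (0 : ℂ) 1) :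
    kernelPow β w z ≠ 0 :=
  fun h => one_sub_conj_mul_ne_zero hw hz ((cpow_eq_zero_iff _ _).1 h).1

theorem analyticOnNhd_kernelPow (β : ℝ) (hw : w ∈ ball (0 : ℂ) 1) :
    AnalyticOnNhd ℂ (kernelPow β w) (ball 0 1) := fun _ hz =>
  AnalyticAt.cpow (by fun_prop) analyticAt_const (one_sub_conj_mul_mem_slitPlane hw hz)

theorem hasSum_kernelPow (α : ℝ) (hw : w ∈ ball (0 : ℂ) 1) (hz : z ∈ ball (0 : ℂ) 1) :
    HasSum (fun n => ((Ring.multichoose α n : ℝ) : ℂ) * conj w ^ n * z ^ n)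
      (kernelPow (-α) w z) := by
  rw [kernelPow, ofReal_neg]
  refine (hasSum_multichoose_mul_pow α (norm_conj_mul_lt_one hw hz)).congr_fun fun n => ?_
  rw [mul_pow, mul_assoc]

theorem isHalfPowerSeries_const_mul_kernelPow (α : ℝ) (hp : p ≠ 0) (hw : w ∈ ball (0 : ℂ) 1)
    (hf : ∀ z ∈ ball (0 : ℂ) 1, f z = C * kernelPow (-2 * α / p) w z) :
    IsHalfPowerSeries p 1 f
      fun n => (‖C‖ ^ (p / 2) : ℝ) * ((Ring.multichoose α n : ℝ) * conj w ^ n) := by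
  have hsum : ∀ z ∈ ball (0 : ℂ) 1, HasSum
      (fun n => ((‖C‖ ^ (p / 2) : ℝ) : ℂ) * ((Ring.multichoose α n : ℝ) * conj w ^ n) * z ^ n)
      ((‖C‖ ^ (p / 2) : ℝ) * kernelPow (-α) w z) := fun z hz =>
    ((hasSum_kernelPow α hw hz).mul_left _).congr_fun fun n => mul_assoc _ _ _
  refine ⟨fun z hz => (hsum z hz).summable, fun z hz => ?_⟩
  rw [(hsum z hz).tsum_eq, hf z hz, norm_mul, norm_mul, norm_real,
    Real.norm_of_nonneg (by positivity), Real.mul_rpow (norm_nonneg _) (norm_nonneg _),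
    norm_kernelPow_rpow α hp, mul_pow, ← Real.rpow_mul_natCast (norm_nonneg _)]
  push_cast
  rw [div_mul_cancel₀ p two_ne_zero]

theorem dirichletNormPow_const_mul_kernelPow (hα : 0 < α) (hp : p ≠ 0) (hw : w ∈ ball (0 : ℂ) 1)
    (hf : ∀ z ∈ ball (0 : ℂ) 1, f z = C * kernelPow (-2 * α / p) w z) :
    dirichletNormPow α p f = ENNReal.ofReal (‖f w‖ ^ p * (1 - ‖w‖ ^ 2) ^ α) := by
  have hpos := one_sub_norm_sq_pos hw
  have hsum := (hasSum_norm_pow_sq_div_inv_multichoose α hw).mul_left (‖C‖ ^ p)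
  have hterm : ∀ n, (Ring.multichoose α n)⁻¹
      * ‖((‖C‖ ^ (p / 2) : ℝ) : ℂ) * ((Ring.multichoose α n : ℝ) * conj w ^ n)‖ ^ 2
      = ‖C‖ ^ p * (‖w ^ n‖ ^ 2 / (Ring.multichoose α n)⁻¹) := fun n => by
    have := multichoose_pos hα n
    rw [norm_mul, norm_mul, norm_real, norm_real, Real.norm_of_nonneg (by positivity),
      Real.norm_of_nonneg (by positivity), norm_pow, norm_pow, norm_conj, mul_pow,
      ← Real.rpow_mul_natCast (norm_nonneg _), Nat.cast_two, div_mul_cancel₀ p two_ne_zero]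
    field_simp
  simp only [(isHalfPowerSeries_const_mul_kernelPow α hp hw hf).dirichletNormPow_eq_tsum hα, hterm]
  rw [← ENNReal.ofReal_tsum_of_nonneg (fun n => ?_) hsum.summable, hsum.tsum_eq, hf w hw, norm_mul,
    Real.mul_rpow (norm_nonneg _) (norm_nonneg _), norm_kernelPow_rpow α hp,
    norm_kernelPow_self _ hw, mul_assoc, sq ((1 - ‖w‖ ^ 2) ^ (-α)), mul_assoc,
    ← Real.rpow_add hpos, neg_add_cancel, Real.rpow_zero, mul_one]
  have := multichoose_pos hα n
  positivity

theorem exists_eq_const_mul_of_norm_eq {U : Set ℂ} {k : ℂ → ℂ} {D : ℝ} (hUo : IsOpen U)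
    (hU : IsPreconnected U) (hf : DifferentiableOn ℂ f U) (hk : DifferentiableOn ℂ k U)
    (hk0 : ∀ z ∈ U, k z ≠ 0) (h : ∀ z ∈ U, ‖f z‖ = D * ‖k z‖) :
    ∃ C, ∀ z ∈ U, f z = C * k z := by
  rcases U.eq_empty_or_nonempty with rfl | ⟨c, hc⟩
  · simp
  have hnorm : ∀ z ∈ U, ‖f z / k z‖ = D := fun z hz => by
    rw [norm_div, h z hz, mul_div_cancel_right₀ _ (norm_ne_zero_iff.2 (hk0 z hz))]
  have hconst := eqOn_of_isPreconnected_of_isMaxOn_norm hU hUo (hf.div hk hk0) hc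
    fun z hz => ((hnorm z hz).trans (hnorm c hc).symm).le
  exact ⟨f c / k c, fun z hz => (div_eq_iff (hk0 z hz)).1 (hconst hz)⟩

theorem exists_eq_const_mul_kernelPow {D : ℝ} (hf : AnalyticOnNhd ℂ f (ball 0 1))
    (hw : w ∈ ball (0 : ℂ) 1) (h : ∀ z ∈ ball (0 : ℂ) 1, ‖f z‖ = D * ‖kernelPow β w z‖) :
    ∃ C, ∀ z ∈ ball (0 : ℂ) 1, f z = C * kernelPow β w z :=
  exists_eq_const_mul_of_norm_eq isOpen_ball (convex_ball 0 1).isPreconnected hf.differentiableOn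
    (analyticOnNhd_kernelPow β hw).differentiableOn (fun _ => kernelPow_ne_zero β hw) h

end KernelPow

section EqualityOfLeOne

variable {α p : ℝ} {f : ℂ → ℂ} {a : ℕ → ℂ} {w : ℂ}

theorem IsHalfPowerSeries.exists_norm_eq_mul_norm_kernelPow (h : IsHalfPowerSeries p 1 f a)
    (hα : 0 < α) (hp : p ≠ 0) (hw : w ∈ ball (0 : ℂ) 1)
    (heq : ENNReal.ofReal (‖f w‖ ^ p * (1 - ‖w‖ ^ 2) ^ α) = dirichletNormPow α p f) :
    ∃ D : ℝ, ∀ z ∈ ball (0 : ℂ) 1, ‖f z‖ = D * ‖kernelPow (-2 * α / p) w z‖ := by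
  have hpos := one_sub_norm_sq_pos hw
  set H := ∑' n, a n * w ^ n
  set K := (1 - ‖w‖ ^ 2) ^ (-α) with hK
  have hnorm : ENNReal.ofReal (‖H‖ ^ 2 / K)
      = ∑' n, ENNReal.ofReal ((Ring.multichoose α n)⁻¹ * ‖a n‖ ^ 2) := by
    rw [hK, Real.rpow_neg hpos.le, div_inv_eq_mul, ← h.norm_rpow_eq w hw, heq,
      h.dirichletNormPow_eq_tsum hα]
  have hcoeff := eq_of_ofReal_norm_sq_div_eq_tsum (fun n => inv_pos.2 (multichoose_pos hα n))
    (h.summable w hw).hasSum (hasSum_norm_pow_sq_div_inv_multichoose α hw) (by positivity) hnorm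
  have hsum : ∀ z ∈ ball (0 : ℂ) 1, ∑' n, a n * z ^ n = H / K * kernelPow (-α) w z := fun z hz => by
    refine (((hasSum_kernelPow α hw hz).mul_left _).congr_fun fun n => ?_).tsum_eq
    rw [hcoeff n, map_pow, ofReal_inv, div_inv_eq_mul]
    ring
  refine ⟨(‖H / K‖ ^ 2) ^ p⁻¹, fun z hz => ?_⟩
  rw [← Real.rpow_left_inj (norm_nonneg _) (by positivity) hp, h.norm_rpow_eq z hz, hsum z hz,
    Real.mul_rpow (by positivity) (norm_nonneg _), Real.rpow_inv_rpow (by positivity) hp,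
    norm_kernelPow_rpow α hp, norm_mul, mul_pow]

theorem ne_zero_of_ofReal_eq_dirichletNormPow (hα : 0 < α) (hα1 : α ≤ 1) (hp : 0 < p)
    (hf : AnalyticOnNhd ℂ f (ball 0 1)) (hw : w ∈ ball (0 : ℂ) 1) (hfw : f w ≠ 0)
    (heq : ENNReal.ofReal (‖f w‖ ^ p * (1 - ‖w‖ ^ 2) ^ α) = dirichletNormPow α p f) :
    ∀ b ∈ ball (0 : ℂ) 1, f b ≠ 0 := fun b hb hfb => by
  have hpos := one_sub_norm_sq_pos hw
  have hle := ofReal_norm_mul_canonicalFactor_rpow_mul_le_dirichletNormPow hα hα1 hp hf hw hfw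
    hb hfb
  rw [← heq, ENNReal.ofReal_le_ofReal_iff (by positivity),
    mul_le_mul_iff_left₀ (Real.rpow_pos_of_pos hpos α),
    Real.rpow_le_rpow_iff (by positivity) (norm_nonneg _) hp] at hle
  exact hle.not_gt (lt_mul_of_one_lt_right (norm_pos_iff.2 hfw)
    (one_lt_norm_canonicalFactor hb hw fun h => hfw (h ▸ hfb)))

theorem eq_zero_of_dirichletNormPow_eq_zero (hα : 0 < α) (hα1 : α ≤ 1) (hp : 0 < p)
    (hf : AnalyticOnNhd ℂ f (ball 0 1)) (h : dirichletNormPow α p f = 0) {z : ℂ}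
    (hz : z ∈ ball (0 : ℂ) 1) : f z = 0 := by
  have hle := ofReal_norm_rpow_mul_le_dirichletNormPow_of_le_one hα hα1 hp hf hz
  rw [h, nonpos_iff_eq_zero, ENNReal.ofReal_eq_zero] at hle
  by_contra hfz
  have := one_sub_norm_sq_pos hz
  exact hle.not_gt (by positivity)

theorem exists_eq_const_mul_kernelPow_of_le_one (hα : 0 < α) (hα1 : α ≤ 1) (hp : 0 < p)
    (hf : AnalyticOnNhd ℂ f (ball 0 1)) (hw : w ∈ ball (0 : ℂ) 1)
    (heq : ENNReal.ofReal (‖f w‖ ^ p * (1 - ‖w‖ ^ 2) ^ α) = dirichletNormPow α p f) :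
    ∃ C, ∀ z ∈ ball (0 : ℂ) 1, f z = C * kernelPow (-2 * α / p) w z := by
  by_cases hfw : f w = 0
  · have hnorm : dirichletNormPow α p f = 0 := by
      rw [← heq, hfw, norm_zero, Real.zero_rpow hp.ne', zero_mul, ENNReal.ofReal_zero]
    exact ⟨0, fun z hz => by
      rw [eq_zero_of_dirichletNormPow_eq_zero hα hα1 hp hf hnorm hz, zero_mul]⟩
  · obtain ⟨a, ha⟩ := exists_isHalfPowerSeries p hf
      (ne_zero_of_ofReal_eq_dirichletNormPow hα hα1 hp hf hw hfw heq)
    obtain ⟨D, hD⟩ := ha.exists_norm_eq_mul_norm_kernelPow hα hp.ne' hw heq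
    exact exists_eq_const_mul_kernelPow hf hw hD

end EqualityOfLeOne

section RadialNorm

variable {α p : ℝ} {f : ℂ → ℂ} {s : ℝ}

theorem radialDensity_pos (hα : 1 < α) (hs : s ∈ Ioo (0 : ℝ) 1) : 0 < radialDensity α s :=
  mul_pos (mul_pos (mul_pos two_pos (sub_pos.2 hα)) hs.1)
    (Real.rpow_pos_of_pos (one_sub_sq_pos hs.1.le hs.2) _)

theorem continuousOn_Ioo_of_continuousOn_Icc {X : Type*} [TopologicalSpace X] {g : ℝ → X}
    {a b : ℝ} (h : ∀ ρ < b, ContinuousOn g (Icc a ρ)) : ContinuousOn g (Ioo a b) := fun s hs => by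
  obtain ⟨ρ, hsρ, hρ⟩ := exists_between hs.2
  exact ((h ρ hρ).continuousAt (Icc_mem_nhds hs.1 hsρ)).continuousWithinAt

theorem setLIntegral_Ioo_le {φ : ℝ → ENNReal} {a b : ℝ} {C : ENNReal} (hab : a < b)
    (h : ∀ ρ ∈ Ioo a b, ∫⁻ s in Ioo a ρ, φ s ≤ C) : ∫⁻ s in Ioo a b, φ s ≤ C := by
  obtain ⟨u, hu, hub, hlim⟩ := exists_seq_strictMono_tendsto' hab
  have hunion : Ioo a b ⊆ ⋃ n, Ioo a (u n) := fun s hs => by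
    obtain ⟨n, hn⟩ := (hlim.eventually_const_lt hs.2).exists
    exact mem_iUnion.2 ⟨n, hs.1, hn⟩
  refine (lintegral_mono_set hunion).trans ?_
  rw [setLIntegral_iUnion_of_directed φ
    (Monotone.directed_le fun m n hmn => Ioo_subset_Ioo_right (hu.monotone hmn))]
  exact iSup_le fun n => h _ (hub n)

theorem setLIntegral_radialDensity (hα : 1 < α) :
    ∫⁻ s in Ioo (0 : ℝ) 1, ENNReal.ofReal (radialDensity α s) = 1 := by
  have hα' : 0 < α - 1 := sub_pos.2 hα
  have hint : IntervalIntegrable (radialDensity α) volume 0 1 :=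
    (intervalIntegrable_one_sub_sq_rpow (by linarith)).continuousOn_mul (by fun_prop)
  have hderiv : ∀ s ∈ Ioo (0 : ℝ) 1,
      HasDerivAt (fun s : ℝ => -(1 - s ^ 2) ^ (α - 1)) (radialDensity α s) s := fun s hs => by
    simpa only [neg_neg] using
      (hasDerivAt_one_sub_sq_rpow_sub_one α (one_sub_sq_pos hs.1.le hs.2).ne').fun_neg
  have hcont : Continuous fun s : ℝ => -(1 - s ^ 2) ^ (α - 1) :=
    (Continuous.rpow_const (by fun_prop) fun _ => Or.inr hα'.le).neg
  rw [setLIntegral_Ioo_ofReal zero_le_one hint fun s hs => (radialDensity_pos hα hs).le,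
    intervalIntegral.integral_eq_sub_of_hasDerivAt_of_le zero_le_one hcont.continuousOn hderiv hint]
  simp [hα'.ne']

/-- The norm of the weighted Bergman space `L_a^p((1 - |z|²) ^ (α - 2))`, for `1 < α`, in polar
form: `∫_0^1 M_p^p(s, f) radialDensity α s ds`. -/
noncomputable def radialNormPow (α p : ℝ) (f : ℂ → ℂ) : ENNReal :=
  ∫⁻ s in Ioo (0 : ℝ) 1, ENNReal.ofReal (integralMeanPow p f s * radialDensity α s)

theorem radialNormPow_le_dirichletNormPow (hα : 1 < α) (hp : 0 < p)
    (hf : AnalyticOnNhd ℂ f (ball 0 1)) : radialNormPow α p f ≤ dirichletNormPow α p f := by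
  refine setLIntegral_Ioo_le one_pos fun ρ hρ => ?_
  have hfρ := hf.mono (closedBall_subset_ball hρ.2)
  calc ∫⁻ s in Ioo 0 ρ, ENNReal.ofReal (integralMeanPow p f s * radialDensity α s)
      = ENNReal.ofReal (∫ s in 0..ρ, integralMeanPow p f s * radialDensity α s) :=
        setLIntegral_Ioo_ofReal hρ.1.le (((continuousOn_integralMeanPow hp hfρ).mul
          (continuousOn_radialDensity α hρ.2)).intervalIntegrable_of_Icc hρ.1.le) fun s hs =>
            mul_nonneg (integralMeanPow_nonneg p f s)
              (radialDensity_pos hα ⟨hs.1, hs.2.trans hρ.2⟩).le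
    _ ≤ truncNormPow α p f ρ := by
        rw [truncNormPow_eq α hp hρ.1 hρ.2 hfρ]
        refine ENNReal.ofReal_le_ofReal (le_add_of_nonneg_left ?_)
        exact mul_nonneg (integralMeanPow_nonneg p f ρ)
          (Real.rpow_nonneg (one_sub_sq_pos hρ.1.le hρ.2).le _)
    _ ≤ dirichletNormPow α p f := truncNormPow_mono α p f hρ.2.le

theorem norm_zero_rpow_le_integralMeanPow (hp : 0 < p) (hf : AnalyticOnNhd ℂ f (ball 0 1))
    (hs : s ∈ Ico (0 : ℝ) 1) : ‖f 0‖ ^ p ≤ integralMeanPow p f s := by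
  rw [← integralMeanPow_zero]
  exact integralMeanPow_le hp (hf.mono (closedBall_subset_ball hs.2)) ⟨le_rfl, hs.1⟩

theorem norm_zero_rpow_mul_radialDensity_le (hα : 1 < α) (hp : 0 < p)
    (hf : AnalyticOnNhd ℂ f (ball 0 1)) (hs : s ∈ Ioo (0 : ℝ) 1) :
    ENNReal.ofReal (‖f 0‖ ^ p * radialDensity α s)
      ≤ ENNReal.ofReal (integralMeanPow p f s * radialDensity α s) :=
  ENNReal.ofReal_le_ofReal (mul_le_mul_of_nonneg_right
    (norm_zero_rpow_le_integralMeanPow hp hf (Ioo_subset_Ico_self hs)) (radialDensity_pos hα hs).le)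

theorem setLIntegral_const_mul_radialDensity (hα : 1 < α) {c : ℝ} (hc : 0 ≤ c) :
    ∫⁻ s in Ioo (0 : ℝ) 1, ENNReal.ofReal (c * radialDensity α s) = ENNReal.ofReal c := by
  simp only [ENNReal.ofReal_mul hc]
  rw [lintegral_const_mul' _ _ ENNReal.ofReal_ne_top, setLIntegral_radialDensity hα, mul_one]

theorem ofReal_norm_zero_rpow_le_radialNormPow (hα : 1 < α) (hp : 0 < p)
    (hf : AnalyticOnNhd ℂ f (ball 0 1)) : ENNReal.ofReal (‖f 0‖ ^ p) ≤ radialNormPow α p f := by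
  rw [← setLIntegral_const_mul_radialDensity hα (by positivity)]
  exact setLIntegral_mono' measurableSet_Ioo fun s => norm_zero_rpow_mul_radialDensity_le hα hp hf

theorem integralMeanPow_eq_of_radialNormPow_le (hα : 1 < α) (hp : 0 < p)
    (hf : AnalyticOnNhd ℂ f (ball 0 1)) (h : radialNormPow α p f ≤ ENNReal.ofReal (‖f 0‖ ^ p))
    (hs : s ∈ Ioo (0 : ℝ) 1) : integralMeanPow p f s = ‖f 0‖ ^ p := by
  have hconst := setLIntegral_const_mul_radialDensity hα (c := ‖f 0‖ ^ p) (by positivity)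
  have hd : ContinuousOn (radialDensity α) (Ioo 0 1) :=
    continuousOn_Ioo_of_continuousOn_Icc fun _ => continuousOn_radialDensity α
  have hM : ContinuousOn (integralMeanPow p f) (Ioo 0 1) :=
    continuousOn_Ioo_of_continuousOn_Icc fun _ hρ =>
      continuousOn_integralMeanPow hp (hf.mono (closedBall_subset_ball hρ))
  have hcontConst := ENNReal.continuous_ofReal.comp_continuousOn
    (continuousOn_const (c := ‖f 0‖ ^ p) |>.mul hd)
  have hcontM := ENNReal.continuous_ofReal.comp_continuousOn (hM.mul hd)
  have hae := ae_eq_of_ae_le_of_lintegral_le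
    ((ae_restrict_iff' measurableSet_Ioo).2
      (.of_forall fun s => norm_zero_rpow_mul_radialDensity_le hα hp hf))
    (hconst ▸ ENNReal.ofReal_ne_top) (hcontM.aemeasurable measurableSet_Ioo) (hconst ▸ h)
  have heq := Measure.eqOn_open_of_ae_eq hae isOpen_Ioo hcontConst hcontM hs
  have hpos := radialDensity_pos hα hs
  exact (mul_right_cancel₀ hpos.ne' ((ENNReal.ofReal_eq_ofReal_iff (by positivity)
    (mul_nonneg (integralMeanPow_nonneg p f s) hpos.le)).1 heq)).symm

theorem eq_apply_zero_of_integralMeanPow_eq (hp : 0 < p) (hf : AnalyticOnNhd ℂ f (ball 0 1))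
    (h : ∀ s ∈ Ioo (0 : ℝ) 1, integralMeanPow p f s = ‖f 0‖ ^ p) {z : ℂ}
    (hz : z ∈ ball (0 : ℂ) 1) : f z = f 0 := by
  have hderiv : ∀ s ∈ Ioo (0 : ℝ) 1, deriv (integralMeanPow p f) s = 0 := fun s hs => by
    have hev : integralMeanPow p f =ᶠ[𝓝 s] fun _ => ‖f 0‖ ^ p :=
      eventually_of_mem (Ioo_mem_nhds hs.1 hs.2) h
    rw [hev.deriv_eq, deriv_const]
  have hnorm : dirichletNormPow 1 p f = ENNReal.ofReal (‖f 0‖ ^ p) := by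
    rw [dirichletNormPow, setLIntegral_congr_fun (g := fun _ => 0) measurableSet_Ioo fun s hs => by
      simp [hderiv s hs], lintegral_zero, add_zero]
  have h0 : (0 : ℂ) ∈ ball (0 : ℂ) 1 := mem_ball_self one_pos
  obtain ⟨C, hC⟩ := exists_eq_const_mul_kernelPow_of_le_one one_pos le_rfl hp hf h0
    (by rw [hnorm]; simp)
  simp only [kernelPow, map_zero, zero_mul, sub_zero, one_cpow, mul_one] at hC
  rw [hC z hz, hC 0 h0]

theorem eq_apply_zero_of_radialNormPow_le (hα : 1 < α) (hp : 0 < p)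
    (hf : AnalyticOnNhd ℂ f (ball 0 1)) (h : radialNormPow α p f ≤ ENNReal.ofReal (‖f 0‖ ^ p))
    {z : ℂ} (hz : z ∈ ball (0 : ℂ) 1) : f z = f 0 :=
  eq_apply_zero_of_integralMeanPow_eq hp hf
    (fun _ => integralMeanPow_eq_of_radialNormPow_le hα hp hf h) hz

end RadialNorm

section PolarCoordinates

variable {R r : ℝ}

theorem polarCoord_symm_eq_circleMap (q : ℝ × ℝ) :
    Complex.polarCoord.symm q = circleMap 0 q.1 q.2 := by
  rw [Complex.polarCoord_symm_apply, circleMap_zero, exp_mul_I, ofReal_cos, ofReal_sin]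

theorem circleMap_zero_mem_ball (hr : r ∈ Ioo 0 R) (θ : ℝ) : circleMap 0 r θ ∈ ball (0 : ℂ) R := by
  simpa [abs_of_pos hr.1] using hr.2

theorem setLIntegral_ball_eq_setLIntegral_polar (φ : ℂ → ENNReal) (R : ℝ) :
    ∫⁻ z in ball (0 : ℂ) R, φ z = ∫⁻ q in Ioo (0 : ℝ) R ×ˢ Ioo (-Real.pi) Real.pi,
      ENNReal.ofReal q.1 * φ (circleMap 0 q.1 q.2) := by
  rw [← lintegral_indicator measurableSet_ball, ← Complex.lintegral_comp_polarCoord_symm,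
    ← lintegral_indicator polarCoord.open_target.measurableSet,
    ← lintegral_indicator (measurableSet_Ioo.prod measurableSet_Ioo)]
  refine lintegral_congr fun q => ?_
  by_cases hq : q ∈ polarCoord.target
  · have hmem : circleMap 0 q.1 q.2 ∈ ball (0 : ℂ) R
        ↔ q ∈ Ioo (0 : ℝ) R ×ˢ Ioo (-Real.pi) Real.pi :=
      ⟨fun h => ⟨⟨hq.1, by simpa [abs_of_pos (show 0 < q.1 from hq.1)] using h⟩, hq.2⟩,
        fun h => circleMap_zero_mem_ball h.1 q.2⟩
    rw [indicator_of_mem hq, polarCoord_symm_eq_circleMap, smul_eq_mul]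
    by_cases hb : circleMap 0 q.1 q.2 ∈ ball (0 : ℂ) R
    · rw [indicator_of_mem hb, indicator_of_mem (hmem.1 hb)]
    · rw [indicator_of_notMem hb, mul_zero, indicator_of_notMem (mt hmem.2 hb)]
  · rw [indicator_of_notMem hq, indicator_of_notMem fun h => hq ⟨h.1.1, h.2⟩]

theorem integral_circleMap_eq_circleAverage (u : ℂ → ℝ) (c : ℂ) (r : ℝ) :
    ∫ θ in -Real.pi..Real.pi, u (circleMap c r θ) = 2 * Real.pi * Real.circleAverage u c r := by
  have hshift := ((periodic_circleMap c r).comp u).intervalIntegral_add_eq (-Real.pi) 0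
  rw [zero_add, two_mul, neg_add_cancel_left] at hshift
  rw [Real.circleAverage_def, smul_eq_mul, mul_inv_cancel_left₀ Real.two_pi_pos.ne', two_mul]
  exact hshift

theorem setLIntegral_ball_ofReal {u : ℂ → ℝ} (hu : ContinuousOn u (ball 0 R))
    (h0 : ∀ z ∈ ball (0 : ℂ) R, 0 ≤ u z) :
    ∫⁻ z in ball (0 : ℂ) R, ENNReal.ofReal (u z)
      = ∫⁻ r in Ioo 0 R, ENNReal.ofReal (2 * Real.pi * r * Real.circleAverage u 0 r) := by
  have hmeas : AEMeasurable
      (fun q : ℝ × ℝ => ENNReal.ofReal q.1 * ENNReal.ofReal (u (circleMap 0 q.1 q.2)))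
      (volume.restrict (Ioo 0 R ×ˢ Ioo (-Real.pi) Real.pi)) := by
    have hcircleMap : Continuous fun q : ℝ × ℝ => circleMap 0 q.1 q.2 := by
      unfold circleMap
      fun_prop
    refine AEMeasurable.mul (by fun_prop) (ContinuousOn.aemeasurable ?_
      (measurableSet_Ioo.prod measurableSet_Ioo)).ennreal_ofReal
    exact hu.comp hcircleMap.continuousOn fun q hq => circleMap_zero_mem_ball hq.1 q.2
  rw [setLIntegral_ball_eq_setLIntegral_polar, Measure.volume_eq_prod, setLIntegral_prod _ hmeas]
  refine setLIntegral_congr_fun measurableSet_Ioo fun r hr => ?_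
  have hcont : Continuous fun θ => u (circleMap 0 r θ) :=
    hu.comp_continuous (continuous_circleMap 0 r) (circleMap_zero_mem_ball hr)
  simp only
  rw [lintegral_const_mul' _ _ ENNReal.ofReal_ne_top,
    setLIntegral_Ioo_ofReal (neg_le_self Real.pi_pos.le) (hcont.intervalIntegrable _ _)
      fun θ _ => h0 _ (circleMap_zero_mem_ball hr θ),
    ← ENNReal.ofReal_mul hr.1.le, integral_circleMap_eq_circleAverage]
  congr 1
  ring

end PolarCoordinates

section AreaDensity

variable {α p : ℝ} {f : ℂ → ℂ}

/-- The density of `radialNormPow α p f` with respect to area. -/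
noncomputable def areaDensity (α p : ℝ) (f : ℂ → ℂ) (z : ℂ) : ℝ :=
  (α - 1) / Real.pi * (1 - ‖z‖ ^ 2) ^ (α - 2) * ‖f z‖ ^ p

theorem areaDensity_nonneg (hα : 1 ≤ α) (p : ℝ) (f : ℂ → ℂ) {z : ℂ} (hz : z ∈ ball (0 : ℂ) 1) :
    0 ≤ areaDensity α p f z := by
  have := sub_nonneg.2 hα
  have := one_sub_norm_sq_pos hz
  unfold areaDensity
  positivity

theorem continuousOn_areaDensity (α : ℝ) (hp : 0 < p) (hf : AnalyticOnNhd ℂ f (ball 0 1)) :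
    ContinuousOn (areaDensity α p f) (ball 0 1) :=
  (continuousOn_const.mul (ContinuousOn.rpow_const (by fun_prop) fun _ hz =>
    Or.inl (one_sub_norm_sq_pos hz).ne')).mul (continuousOn_norm_rpow hp hf)

theorem circleAverage_areaDensity (α p : ℝ) (f : ℂ → ℂ) (r : ℝ) :
    Real.circleAverage (areaDensity α p f) 0 r
      = (α - 1) / Real.pi * (1 - r ^ 2) ^ (α - 2) * integralMeanPow p f r := by
  rw [integralMeanPow, ← smul_eq_mul (_ * _), ← Real.circleAverage_fun_smul]
  refine Real.circleAverage_congr_sphere fun z hz => ?_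
  rw [areaDensity, mem_sphere_zero_iff_norm.1 hz, sq_abs, smul_eq_mul]

theorem radialNormPow_eq_setLIntegral_areaDensity (hα : 1 ≤ α) (hp : 0 < p)
    (hf : AnalyticOnNhd ℂ f (ball 0 1)) :
    radialNormPow α p f = ∫⁻ z in ball (0 : ℂ) 1, ENNReal.ofReal (areaDensity α p f z) := by
  rw [setLIntegral_ball_ofReal (continuousOn_areaDensity α hp hf)
    fun _ => areaDensity_nonneg hα p f, radialNormPow]
  refine lintegral_congr fun r => ?_
  rw [circleAverage_areaDensity, radialDensity]
  congr 1
  field_simp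

end AreaDensity

section DiscInvolution

variable {w z : ℂ}

/-- The involutive automorphism `z ↦ (w - z) / (1 - w̄z)` of the unit disc, exchanging `0` and
`w`. -/
noncomputable def discInvolution (w z : ℂ) : ℂ :=
  (w - z) / (1 - conj w * z)

theorem discInvolution_zero (w : ℂ) : discInvolution w 0 = w := by
  simp [discInvolution]

theorem one_sub_norm_sq_discInvolution (hw : w ∈ ball (0 : ℂ) 1) (hz : z ∈ ball (0 : ℂ) 1) :
    1 - ‖discInvolution w z‖ ^ 2
      = (1 - ‖w‖ ^ 2) * (1 - ‖z‖ ^ 2) / ‖1 - conj w * z‖ ^ 2 := by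
  have h0 : ‖1 - conj w * z‖ ^ 2 ≠ 0 :=
    pow_ne_zero 2 (norm_ne_zero_iff.2 (one_sub_conj_mul_ne_zero hw hz))
  have h := norm_sq_sub_conj_mul 1 w z
  simp only [ofReal_one, one_pow, one_mul] at h
  rw [discInvolution, norm_div, div_pow, norm_sub_rev w z, ← h, sub_div, div_self h0]

theorem discInvolution_mem_ball (hw : w ∈ ball (0 : ℂ) 1) (hz : z ∈ ball (0 : ℂ) 1) :
    discInvolution w z ∈ ball (0 : ℂ) 1 := by
  have h0 := norm_pos_iff.2 (one_sub_conj_mul_ne_zero hw hz)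
  have hpos : 0 < 1 - ‖discInvolution w z‖ ^ 2 := by
    rw [one_sub_norm_sq_discInvolution hw hz]
    have := one_sub_norm_sq_pos hw
    have := one_sub_norm_sq_pos hz
    positivity
  rw [mem_ball_zero_iff, ← sq_lt_one_iff₀ (norm_nonneg _)]
  exact sub_pos.1 hpos

theorem one_sub_conj_mul_discInvolution (hw : w ∈ ball (0 : ℂ) 1) (hz : z ∈ ball (0 : ℂ) 1) :
    1 - conj w * discInvolution w z = (1 - conj w * w) / (1 - conj w * z) := by
  have h0 := one_sub_conj_mul_ne_zero hw hz
  rw [discInvolution]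
  field_simp
  ring

theorem discInvolution_discInvolution (hw : w ∈ ball (0 : ℂ) 1) (hz : z ∈ ball (0 : ℂ) 1) :
    discInvolution w (discInvolution w z) = z := by
  have h0 := one_sub_conj_mul_ne_zero hw hz
  have h1 := one_sub_conj_mul_ne_zero hw hw
  rw [discInvolution, one_sub_conj_mul_discInvolution hw hz, div_eq_iff (div_ne_zero h1 h0),
    discInvolution, sub_div' h0, mul_div_assoc']
  ring

theorem image_discInvolution_ball (hw : w ∈ ball (0 : ℂ) 1) :
    discInvolution w '' ball 0 1 = ball 0 1 :=
  (image_subset_iff.2 fun _ => discInvolution_mem_ball hw).antisymm fun z hz =>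
    ⟨discInvolution w z, discInvolution_mem_ball hw hz, discInvolution_discInvolution hw hz⟩

theorem injOn_discInvolution_ball (hw : w ∈ ball (0 : ℂ) 1) :
    InjOn (discInvolution w) (ball 0 1) :=
  LeftInvOn.injOn fun _ => discInvolution_discInvolution hw

theorem hasDerivAt_discInvolution (hw : w ∈ ball (0 : ℂ) 1) (hz : z ∈ ball (0 : ℂ) 1) :
    HasDerivAt (discInvolution w) (-(1 - conj w * w) / (1 - conj w * z) ^ 2) z := by
  have hnum : HasDerivAt (fun z => w - z) (-1) z := (hasDerivAt_id z).const_sub w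
  have hden : HasDerivAt (fun z => 1 - conj w * z) (-conj w) z := by
    simpa using ((hasDerivAt_id z).const_mul (conj w)).const_sub 1
  refine (hnum.div hden (one_sub_conj_mul_ne_zero hw hz)).congr_deriv ?_
  ring

theorem setLIntegral_image_eq_setLIntegral_norm_deriv {φ φ' : ℂ → ℂ} {s : Set ℂ}
    (hs : MeasurableSet s) (hφ : ∀ z ∈ s, HasDerivAt φ (φ' z) z) (hinj : InjOn φ s)
    (g : ℂ → ENNReal) :
    ∫⁻ z in φ '' s, g z = ∫⁻ z in s, ENNReal.ofReal (‖φ' z‖ ^ 2) * g (φ z) := by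
  rw [lintegral_image_eq_lintegral_abs_det_fderiv_mul volume hs
    (fun z hz => ((hφ z hz).hasFDerivAt.restrictScalars ℝ).hasFDerivWithinAt) hinj]
  simp [ContinuousLinearMap.det, LinearMap.det_restrictScalars, Algebra.norm_complex_eq,
    normSq_eq_norm_sq]

theorem setLIntegral_ball_eq_setLIntegral_discInvolution (hw : w ∈ ball (0 : ℂ) 1)
    (g : ℂ → ENNReal) :
    ∫⁻ z in ball (0 : ℂ) 1, g z = ∫⁻ z in ball (0 : ℂ) 1,
      ENNReal.ofReal (((1 - ‖w‖ ^ 2) / ‖1 - conj w * z‖ ^ 2) ^ 2) * g (discInvolution w z) := by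
  conv_lhs => rw [← image_discInvolution_ball hw]
  rw [setLIntegral_image_eq_setLIntegral_norm_deriv measurableSet_ball
    (fun _ => hasDerivAt_discInvolution hw) (injOn_discInvolution_ball hw)]
  simp only [norm_div, norm_neg, norm_pow, norm_one_sub_conj_mul_self hw]

end DiscInvolution

section OneLt

variable {α p : ℝ} {f : ℂ → ℂ} {w z : ℂ}

/-- The pullback of `f` under `discInvolution w`, weighted so that `radialNormPow α p` is preserved
up to a constant. -/
noncomputable def weightedComp (α p : ℝ) (w : ℂ) (f : ℂ → ℂ) (z : ℂ) : ℂ :=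
  f (discInvolution w z) * kernelPow (-2 * α / p) w z

theorem weightedComp_zero (α p : ℝ) (w : ℂ) (f : ℂ → ℂ) : weightedComp α p w f 0 = f w := by
  simp [weightedComp, discInvolution_zero, kernelPow]

theorem analyticOnNhd_weightedComp (α p : ℝ) (hw : w ∈ ball (0 : ℂ) 1)
    (hf : AnalyticOnNhd ℂ f (ball 0 1)) : AnalyticOnNhd ℂ (weightedComp α p w f) (ball 0 1) := by
  have hφ : DifferentiableOn ℂ (discInvolution w) (ball 0 1) := fun z hz =>
    (hasDerivAt_discInvolution hw hz).differentiableAt.differentiableWithinAt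
  exact ((hf.differentiableOn.comp hφ fun _ => discInvolution_mem_ball hw).mul
    (analyticOnNhd_kernelPow _ hw).differentiableOn).analyticOnNhd isOpen_ball

theorem mul_areaDensity_discInvolution (hp : p ≠ 0) (hw : w ∈ ball (0 : ℂ) 1)
    (hz : z ∈ ball (0 : ℂ) 1) :
    ((1 - ‖w‖ ^ 2) / ‖1 - conj w * z‖ ^ 2) ^ 2 * areaDensity α p f (discInvolution w z)
      = (1 - ‖w‖ ^ 2) ^ α * areaDensity α p (weightedComp α p w f) z := by
  have hwpos := one_sub_norm_sq_pos hw
  have hzpos := one_sub_norm_sq_pos hz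
  have hupos := norm_pos_iff.2 (one_sub_conj_mul_ne_zero hw hz)
  have hkernel : ‖kernelPow (-2 * α / p) w z‖ ^ p = ((‖1 - conj w * z‖ ^ 2) ^ α)⁻¹ := by
    rw [norm_kernelPow_rpow α hp, norm_kernelPow, Real.rpow_neg hupos.le, inv_pow,
      Real.rpow_pow_comm hupos.le]
  have hsplit : ∀ {x : ℝ}, 0 < x → x ^ α = x ^ (α - 2) * x ^ 2 := fun hx => by
    rw [← Real.rpow_add_natCast hx.ne', Nat.cast_two, sub_add_cancel]
  rw [areaDensity, areaDensity, weightedComp, norm_mul,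
    Real.mul_rpow (norm_nonneg _) (norm_nonneg _), hkernel, one_sub_norm_sq_discInvolution hw hz,
    Real.div_rpow (by positivity) (by positivity), Real.mul_rpow hwpos.le hzpos.le,
    hsplit hwpos, hsplit (pow_pos hupos 2)]
  field_simp

theorem radialNormPow_eq_mul_radialNormPow_weightedComp (hα : 1 ≤ α) (hp : 0 < p)
    (hw : w ∈ ball (0 : ℂ) 1) (hf : AnalyticOnNhd ℂ f (ball 0 1)) :
    radialNormPow α p f
      = ENNReal.ofReal ((1 - ‖w‖ ^ 2) ^ α) * radialNormPow α p (weightedComp α p w f) := by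
  have hwpos := one_sub_norm_sq_pos hw
  rw [radialNormPow_eq_setLIntegral_areaDensity hα hp hf,
    radialNormPow_eq_setLIntegral_areaDensity hα hp (analyticOnNhd_weightedComp α p hw hf),
    setLIntegral_ball_eq_setLIntegral_discInvolution hw,
    ← lintegral_const_mul' _ _ ENNReal.ofReal_ne_top]
  refine setLIntegral_congr_fun measurableSet_ball fun z hz => ?_
  rw [← ENNReal.ofReal_mul (by positivity), ← ENNReal.ofReal_mul (by positivity),
    mul_areaDensity_discInvolution hp.ne' hw hz]

theorem ofReal_norm_rpow_mul_eq (α p : ℝ) (f : ℂ → ℂ) (w : ℂ) :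
    ENNReal.ofReal (‖f w‖ ^ p * (1 - ‖w‖ ^ 2) ^ α)
      = ENNReal.ofReal ((1 - ‖w‖ ^ 2) ^ α) * ENNReal.ofReal (‖weightedComp α p w f 0‖ ^ p) := by
  rw [weightedComp_zero, mul_comm, ENNReal.ofReal_mul' (by positivity)]

theorem ofReal_norm_rpow_mul_le_dirichletNormPow_of_one_lt (hα : 1 < α) (hp : 0 < p)
    (hf : AnalyticOnNhd ℂ f (ball 0 1)) (hw : w ∈ ball (0 : ℂ) 1) :
    ENNReal.ofReal (‖f w‖ ^ p * (1 - ‖w‖ ^ 2) ^ α) ≤ dirichletNormPow α p f := by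
  refine le_trans ?_ (radialNormPow_le_dirichletNormPow hα hp hf)
  rw [radialNormPow_eq_mul_radialNormPow_weightedComp hα.le hp hw hf, ofReal_norm_rpow_mul_eq]
  gcongr
  exact ofReal_norm_zero_rpow_le_radialNormPow hα hp (analyticOnNhd_weightedComp α p hw hf)

theorem norm_kernelPow_discInvolution (β : ℝ) (hw : w ∈ ball (0 : ℂ) 1)
    (hz : z ∈ ball (0 : ℂ) 1) :
    ‖kernelPow β w (discInvolution w z)‖ = (1 - ‖w‖ ^ 2) ^ β / ‖kernelPow β w z‖ := by
  rw [norm_kernelPow, norm_kernelPow, one_sub_conj_mul_discInvolution hw hz, norm_div,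
    norm_one_sub_conj_mul_self hw,
    Real.div_rpow (one_sub_norm_sq_pos hw).le (norm_nonneg _)]

theorem exists_eq_const_mul_kernelPow_of_one_lt (hα : 1 < α) (hp : 0 < p)
    (hf : AnalyticOnNhd ℂ f (ball 0 1)) (hw : w ∈ ball (0 : ℂ) 1)
    (heq : ENNReal.ofReal (‖f w‖ ^ p * (1 - ‖w‖ ^ 2) ^ α) = dirichletNormPow α p f) :
    ∃ C, ∀ z ∈ ball (0 : ℂ) 1, f z = C * kernelPow (-2 * α / p) w z := by
  have hwpos := one_sub_norm_sq_pos hw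
  have hradial : radialNormPow α p (weightedComp α p w f)
      ≤ ENNReal.ofReal (‖weightedComp α p w f 0‖ ^ p) := by
    have hle := radialNormPow_le_dirichletNormPow hα hp hf
    rwa [← heq, radialNormPow_eq_mul_radialNormPow_weightedComp hα.le hp hw hf,
      ofReal_norm_rpow_mul_eq, ENNReal.mul_le_mul_iff_right
        (ENNReal.ofReal_pos.2 (Real.rpow_pos_of_pos hwpos α)).ne' ENNReal.ofReal_ne_top] at hle
  refine exists_eq_const_mul_kernelPow (D := ‖f w‖ / (1 - ‖w‖ ^ 2) ^ (-2 * α / p)) hf hw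
    fun z hz => ?_
  have hconst : f z * kernelPow (-2 * α / p) w (discInvolution w z) = f w := by
    have h := eq_apply_zero_of_radialNormPow_le hα hp (analyticOnNhd_weightedComp α p hw hf) hradial
      (discInvolution_mem_ball hw hz)
    rwa [weightedComp_zero, weightedComp, discInvolution_discInvolution hw hz] at h
  have hkernel := norm_pos_iff.2 (kernelPow_ne_zero (-2 * α / p) hw hz)
  rw [← hconst, norm_mul, norm_kernelPow_discInvolution _ hw hz, mul_div_assoc, div_right_comm,
    div_self (Real.rpow_pos_of_pos hwpos _).ne', mul_assoc, one_div_mul_cancel hkernel.ne', mul_one]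

end OneLt

end

theorem corollary1p2 (α p : ℝ) (hα : 0 < α) (hp : 0 < p) :
    (∀ f ∈ dirichletClass α p, ∀ w ∈ Metric.ball (0 : ℂ) 1,
      ENNReal.ofReal (‖f w‖ ^ p * (1 - ‖w‖ ^ 2) ^ α) ≤ dirichletNormPow α p f) ∧
    (∀ f : ℂ → ℂ, ∀ w ∈ Metric.ball (0 : ℂ) 1,
      (f ∈ dirichletClass α p ∧
        ENNReal.ofReal (‖f w‖ ^ p * (1 - ‖w‖ ^ 2) ^ α) = dirichletNormPow α p f) ↔
      ∃ C : ℂ, ∀ z ∈ Metric.ball (0 : ℂ) 1,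
        f z = C * (1 - (starRingEnd ℂ) w * z) ^ (((-2 * α / p : ℝ)) : ℂ)) := by
  refine ⟨fun f hf w hw => ?_, fun f w hw => ⟨fun ⟨hf, heq⟩ => ?_, fun ⟨C, hC⟩ => ?_⟩⟩
  · rcases le_or_gt α 1 with hα1 | hα1
    · exact ofReal_norm_rpow_mul_le_dirichletNormPow_of_le_one hα hα1 hp hf.1 hw
    · exact ofReal_norm_rpow_mul_le_dirichletNormPow_of_one_lt hα1 hp hf.1 hw
  · rcases le_or_gt α 1 with hα1 | hα1
    · exact exists_eq_const_mul_kernelPow_of_le_one hα hα1 hp hf.1 hw heq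
    · exact exists_eq_const_mul_kernelPow_of_one_lt hα1 hp hf.1 hw heq
  · have hnorm := dirichletNormPow_const_mul_kernelPow hα hp.ne' hw hC
    have hanalytic : AnalyticOnNhd ℂ f (Metric.ball 0 1) :=
      (analyticOnNhd_const.mul (analyticOnNhd_kernelPow _ hw)).congr Metric.isOpen_ball
        fun z hz => (hC z hz).symm
    exact ⟨⟨hanalytic, hnorm ▸ ENNReal.ofReal_lt_top⟩, hnorm.symm⟩
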